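/- **Conventions.** $A^*$ and $A^+$ denote the free monoid and free semigroup on $A$; the empty word is written $1$. Let $\langle A\mid R\rangle$, $R\subseteq A^+\times A^+$, be a semigroup presentation, and write $r=(r_{+1},r_{-1})$ for $r\in R$. Its derivation graph $\Gamma(\langle A\mid R\rangle)$ has vertex set $A^+$ and edges $\mathbb E=(w_1,r,\epsilon,w_2)$ with $w_1,w_2\in A^*$, $r\in R$, $\epsilon\in\{+1,-1\}$, where $\iota\mathbb E=w_1r_\epsilon w_2$, $\tau\mathbb E=w_1r_{-\epsilon}w_2$ and $\mathbb E^{-1}=(w_1,r,-\epsilon,w_2)$. Paths are finite sequences of composable edges, including an empty path $1_w$ at each vertex $w$; $\iota\mathbb P,\tau\mathbb P$ are the initial and terminal vertices of the path $\mathbb P$. $A^*$ acts on both sides of edges by $x\cdot(w_1,r,\epsilon,w_2)\cdot y=(xw_1,r,\epsilon,w_2y)$, and edgewise on paths. Two paths are parallel if they have the same initial and the same terminal vertex. A homotopy relation is an equivalence relation $\sim$ on paths, contained in the relation of being parallel, such that (H1) $(\mathbb E_1\cdot\iota\mathbb E_2)(\tau\mathbb E_1\cdot\mathbb E_2)\sim(\iota\mathbb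 E_1\cdot\mathbb E_2)(\mathbb E_1\cdot\tau\mathbb E_2)$ for all edges $\mathbb E_1,\mathbb E_2$; (H2) $\mathbb P\sim\mathbb Q$ implies $x\cdot\mathbb P\cdot y\sim x\cdot\mathbb Q\cdot y$ for $x,y\in A^*$; (H3) $\mathbb P\sim\mathbb Q$ implies $\mathbb T\mathbb P\mathbb T'\sim\mathbb T\mathbb Q\mathbb T'$ whenever these are defined; (H4) $\mathbb P\mathbb P^{-1}\sim 1_{\iota\mathbb P}$. A set $X$ of closed paths is a homotopy base if the smallest homotopy relation containing all pairs $(\mathbb P,1_{\iota\mathbb P})$, $\mathbb P\in X$, is the relation of being parallel. **Setting.** Let $\langle A\mid R\rangle$ be a semigroup presentation defining a semigroup $S$, let $X$ be a homotopy base for it consisting of closed paths, and let $G$ be a subgroup of $S$ (a subsemigroup that is a group). The right cosets of $G$ are the sets $Gs$, $s\in S$, such that $Gss'=G$ for some $s'\in S$; let $(C_i)_{i\in I}$ list them without repetition, with $1\in I$ and $C_1=G$. For $i\in I$, $w\in A^*$, let $iw=k$ if $C_iw=C_k$ and $iw=0$ if $C_iw$ is not a right coset, where $w\in A^+$ acts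 by right multiplication by the element it represents, and the empty word acts as the identity. Let $e\in A^+$ be a word representing the identity of $G$, let $r_1=r_1'=1$ (the empty word), and for $i\in I\setminus\{1\}$ let $r_i,r_i'\in A^+$ be any words with $Gr_i=C_i$ and $g\,r_ir_i'=g$ in $S$ for all $g\in G$. Put $B=\{[i,a]: i\in I,\ a\in A,\ ia\ne0\}$. For $iw\neq 0$ define $\phi(i,w)\in B^*$ by $\phi(i,1)=1$ and $\phi(i,aw)=[i,a]\,\phi(ia,w)$; let $\phi(w)=\phi(1,w)$. Let $\psi:B^*\to A^*$ be the homomorphism with $\psi([i,a])=e\,r_i\,a\,r_{ia}'$. Let $U\subseteq B^+\times B^+$ be the set of relations $$\phi(i,u)=\phi(i,v)\quad(i\in I,\ (u=v)\in R,\ iu\ne0),\qquad [i,a]=\phi(e\,r_i\,a\,r_{ia}')\quad(i\in I,\ a\in A,\ ia\neq0).$$ For an edge $\mathbb E=(w_1,r,\epsilon,w_2)$ of $\Gamma(\langle A\mid R\rangle)$ with $i(\iota\mathbb E)\ne0$ let $$\phi(i,\mathbb E)=\bigl(\phi(i,w_1),\ \phi(iw_1,r_{+1})=\phi(iw_1,r_{-1}),\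 \epsilon,\ \phi(iw_1r_{+1},w_2)\bigr),$$ and extend $\phi(i,-)$ edgewise to the paths $\mathbb P$ with $i(\iota\mathbb P)\neq0$, with $\phi(i,1_w)=1_{\phi(i,w)}$; let $\phi(\mathbb P)=\phi(1,\mathbb P)$. For $u\in U$ let $\mathbb E_u=(1,u,+1,1)$ and let $\psi(\mathbb E_u)$ be any path in $\Gamma(\langle A\mid R\rangle)$ from $\psi(u_{+1})$ to $\psi(u_{-1})$. For $w\in B^+$ define a path $\Lambda_w$ from $w$ to $\phi(\psi(w))$ in $\Gamma(\langle B\mid U\rangle)$ by letting $\Lambda_b$, for $b\in B$, be the edge $(1,\ b=\phi(\psi(b)),\ +1,\ 1)$, and $\Lambda_{bw'}=(\Lambda_b\cdot w')(\phi(\psi(b))\cdot\Lambda_{w'})$ for $b\in B$, $w'\in B^+$. **Theorem.** $\langle B\mid U\rangle$ is a semigroup presentation defining $G$, where $b\in B$ represents the element of $G$ represented by $\psi(b)$. The set $K\cup W$, where $$K=\{\phi(j,\mathbb P):\mathbb P\in X,\ j\in I,\ j(\iota\mathbb P)\ne0\},\qquad W=\{\mathbb E_r\,\Lambda_{r_{-1}}\,\phi(\psi(\mathbb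 E_r))^{-1}\,\Lambda_{r_{+1}}^{-1}: r\in U\},$$ consists of closed paths of $\Gamma(\langle B\mid U\rangle)$ and is a homotopy base for $\langle B\mid U\rangle$. -/

import Mathlib

namespace HomotopyBases

/-! ### Words, semigroup presentations, derivation graphs -/

/-- Words over `A` (elements of the free monoid `A*`) are lists, the empty word is `[]`, and `A⁺`
is the set of words `≠ []`. The element represented by a word when the letter `a` represents
`f a`; it is taken in `S` with a new identity adjoined, the empty word representing that new
identity. A word `≠ []` has its value in `S`. -/
def val {A S : Type*} [Semigroup S] (f : A → S) (w : List A) : WithOne S :=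
  (w.map fun a => (f a : WithOne S)).prod

/-- One-step rewriting `u →_R v`. -/
def Step {A : Type*} (R : Set (List A × List A)) (u v : List A) : Prop :=
  ∃ r ∈ R, ∃ w₁ w₂ : List A, u = w₁ ++ r.1 ++ w₂ ∧ v = w₁ ++ r.2 ++ w₂

/-- `⟨A | R⟩` is a semigroup presentation (`R ⊆ A⁺ × A⁺`) defining the semigroup `S`, with the
letter `a` representing `f a`: the map `A⁺ → S` induced by `f` is onto, and two words have the
same image if and only if they are related by `↔*_R`. -/
structure Presents {A S : Type*} [Semigroup S] (R : Set (List A × List A)) (f : A → S) :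
    Prop where
  rules_nonempty : ∀ r ∈ R, r.1 ≠ [] ∧ r.2 ≠ []
  surjective : ∀ s : S, ∃ w : List A, w ≠ [] ∧ val f w = (s : WithOne S)
  eq_iff : ∀ u v : List A, u ≠ [] → v ≠ [] →
    (val f u = val f v ↔ Relation.EqvGen (Step R) u v)

/-- 4-tuples `(w₁, r, ε, w₂)`, with `r = (r₊₁, r₋₁)` a pair of words; `sign = true` is `ε = +1`
and `sign = false` is `ε = -1`. Such a tuple is an edge of the derivation graph of `⟨A | R⟩`
if `rule ∈ R`. -/
structure DEdge (A : Type*) where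
  left : List A
  rule : List A × List A
  sign : Bool
  right : List A

namespace DEdge

variable {A : Type*}

/-- Initial vertex `ι E = w₁ r_ε w₂`. -/
def src (E : DEdge A) : List A :=
  E.left ++ (if E.sign then E.rule.1 else E.rule.2) ++ E.right

/-- Terminal vertex `τ E = w₁ r_{-ε} w₂`. -/
def tgt (E : DEdge A) : List A :=
  E.left ++ (if E.sign then E.rule.2 else E.rule.1) ++ E.right

/-- `E⁻¹ = (w₁, r, -ε, w₂)`. -/
def inv (E : DEdge A) : DEdge A := ⟨E.left, E.rule, !E.sign, E.right⟩

/-- `x · E · y`. -/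
def act (x : List A) (E : DEdge A) (y : List A) : DEdge A :=
  ⟨x ++ E.left, E.rule, E.sign, E.right ++ y⟩

end DEdge

/-- A vertex together with a list of 4-tuples; the paths of a derivation graph are those
that satisfy `IsPath` below. The empty path at `w` is `⟨w, []⟩`. -/
structure DPath (A : Type*) where
  start : List A
  edges : List (DEdge A)

/-- The edges of the list have rules in `R`, and they can be composed, beginning at `v`. -/
def IsChain {A : Type*} (R : Set (List A × List A)) : List A → List (DEdge A) → Prop
  | _, [] => True
  | v, E :: l => E.rule ∈ R ∧ E.src = v ∧ IsChain R E.tgt l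

/-- The vertex reached from `v` along a list of edges. -/
def endVertex {A : Type*} : List A → List (DEdge A) → List A
  | v, [] => v
  | _, E :: l => endVertex E.tgt l

namespace DPath

variable {A : Type*}

/-- Terminal vertex `τ P`; the initial vertex `ι P` is `P.start`. -/
def tgt (P : DPath A) : List A := endVertex P.start P.edges

/-- The empty path `1_w`. -/
def nil (w : List A) : DPath A := ⟨w, []⟩

/-- The path with the single edge `E`. -/
def ofEdge (E : DEdge A) : DPath A := ⟨E.src, [E]⟩

/-- Composition of paths (used when `τ P = ι Q`). -/
def comp (P Q : DPath A) : DPath A := ⟨P.start, P.edges ++ Q.edges⟩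

/-- The inverse path. -/
def inv (P : DPath A) : DPath A := ⟨P.tgt, (P.edges.map DEdge.inv).reverse⟩

/-- `x · P · y`. -/
def act (x : List A) (P : DPath A) (y : List A) : DPath A :=
  ⟨x ++ P.start ++ y, P.edges.map fun E => DEdge.act x E y⟩

end DPath

/-- `P` is a path of the derivation graph `Γ(⟨A | R⟩)`, whose vertex set is `A⁺`. -/
def IsPath {A : Type*} (R : Set (List A × List A)) (P : DPath A) : Prop :=
  P.start ≠ [] ∧ IsChain R P.start P.edges

/-- Parallel paths of the derivation graph. -/
def Parallel {A : Type*} (R : Set (List A × List A)) (P Q : DPath A) : Prop :=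
  IsPath R P ∧ IsPath R Q ∧ P.start = Q.start ∧ P.tgt = Q.tgt

/-- Homotopy relations on the set of paths of the derivation graph. -/
structure IsHomotopyRelation {A : Type*} (R : Set (List A × List A))
    (sim : DPath A → DPath A → Prop) : Prop where
  parallel : ∀ P Q, sim P Q → Parallel R P Q
  refl : ∀ P, IsPath R P → sim P P
  symm : ∀ P Q, sim P Q → sim Q P
  trans : ∀ P Q T, sim P Q → sim Q T → sim P T
  h1 : ∀ E₁ E₂ : DEdge A, E₁.rule ∈ R → E₂.rule ∈ R →
    sim (((DPath.ofEdge E₁).act [] E₂.src).comp ((DPath.ofEdge E₂).act E₁.tgt []))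
      (((DPath.ofEdge E₂).act E₁.src []).comp ((DPath.ofEdge E₁).act [] E₂.tgt))
  h2 : ∀ P Q, sim P Q → ∀ x y : List A, sim (P.act x y) (Q.act x y)
  h3 : ∀ P Q T T', sim P Q → IsPath R T → IsPath R T' → T.tgt = P.start → T'.start = P.tgt →
    sim ((T.comp P).comp T') ((T.comp Q).comp T')
  h4 : ∀ P, IsPath R P → sim (P.comp P.inv) (DPath.nil P.start)

/-- The homotopy relation generated by `C`: the intersection of all homotopy relations
containing `C`. -/
def Generated {A : Type*} (R : Set (List A × List A)) (C : Set (DPath A × DPath A))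
    (P Q : DPath A) : Prop :=
  ∀ sim : DPath A → DPath A → Prop, IsHomotopyRelation R sim →
    (∀ p ∈ C, sim p.1 p.2) → sim P Q

/-- A set of pairs of parallel paths that generates the relation of being parallel. -/
def IsHomotopyBase {A : Type*} (R : Set (List A × List A)) (C : Set (DPath A × DPath A)) :
    Prop :=
  (∀ p ∈ C, Parallel R p.1 p.2) ∧ ∀ P Q : DPath A, Generated R C P Q ↔ Parallel R P Q

/-- `X` is a set of closed paths of the derivation graph of `⟨A | R⟩`, and it is a homotopy
base, i.e. the set of pairs `(P, 1_{ι P})` with `P ∈ X` is one. -/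
def IsClosedHomotopyBase {A : Type*} (R : Set (List A × List A)) (X : Set (DPath A)) : Prop :=
  (∀ P ∈ X, IsPath R P ∧ P.tgt = P.start) ∧
    IsHomotopyBase R ((fun P => (P, DPath.nil P.start)) '' X)

/-! ### Subgroups of semigroups and their right cosets -/

section Coset

variable {A S : Type*} [Semigroup S]

/-- `x` is the identity element of `G`. -/
def IsIdentityOf (G : Subsemigroup S) (x : S) : Prop :=
  x ∈ G ∧ ∀ g ∈ G, x * g = g ∧ g * x = g

/-- The subsemigroup `G` of `S` is a group (its identity need not be an identity of `S`). -/
def IsSubgroup (G : Subsemigroup S) : Prop :=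
  ∃ x, IsIdentityOf G x ∧ ∀ g ∈ G, ∃ h ∈ G, g * h = x ∧ h * g = x

/-- `C` is a right coset of `G`: `C = G s` for some `s ∈ S` such that `G s s' = G` for some
`s' ∈ S`. -/
def IsRightCoset (G : Subsemigroup S) (C : Set S) : Prop :=
  ∃ s : S, C = (fun x => x * s) '' (G : Set S) ∧
    ∃ s' : S, (fun x => x * s') '' C = (G : Set S)

/-- The translate of `C` by the element that the word `w` represents (`C` itself if `w` is
empty). For a coset `C_i`, "`i w ≠ 0`" means that `wordAct f C_i w`
is again a right coset of `G`. -/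
def wordAct (f : A → S) (C : Set S) (w : List A) : Set S :=
  {t | ∃ c ∈ C, (t : WithOne S) = (c : WithOne S) * val f w}

/-- The alphabet `B` of all `[i, a]` with `i a ≠ 0`. The right cosets of `G` serve as their own
indices; the index `1` is `G`. -/
abbrev Letter (f : A → S) (G : Subsemigroup S) : Type _ :=
  {b : Set S × A // IsRightCoset G b.1 ∧ IsRightCoset G (wordAct f b.1 [b.2])}

open Classical in
/-- `φ(i, w)`, by `φ(i, 1) = 1` and `φ(i, a w) = [i, a] φ(i a, w)`. It is only meaningful if
`i w ≠ 0`. -/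
noncomputable def phi (f : A → S) (G : Subsemigroup S) : Set S → List A → List (Letter f G)
  | _, [] => []
  | C, a :: w =>
    if h : IsRightCoset G C ∧ IsRightCoset G (wordAct f C [a]) then
      ⟨(C, a), h⟩ :: phi f G (wordAct f C [a]) w
    else []

/-- `φ(i, E)` for an edge `E = (w₁, r, ε, w₂)` with `i (ι E) ≠ 0`. -/
noncomputable def phiEdge (f : A → S) (G : Subsemigroup S) (C : Set S) (E : DEdge A) :
    DEdge (Letter f G) where
  left := phi f G C E.left
  rule := (phi f G (wordAct f C E.left) E.rule.1, phi f G (wordAct f C E.left) E.rule.2)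
  sign := E.sign
  right := phi f G (wordAct f C (E.left ++ E.rule.1)) E.right

/-- `φ(i, P)` for a path `P` with `i (ι P) ≠ 0`. -/
noncomputable def phiPath (f : A → S) (G : Subsemigroup S) (C : Set S) (P : DPath A) :
    DPath (Letter f G) :=
  ⟨phi f G C P.start, P.edges.map (phiEdge f G C)⟩

/-- The words fixed in the construction: `e ∈ A⁺` represents the identity of `G`;
`r C, r' C` are `r_i, r_i'` for the coset `C = C_i`. They are empty for `C = G`, and for
the other cosets they are words in `A⁺` such that `G r_i = C_i` and `g r_i r_i' = g` for all
`g ∈ G`. (Values of `r` and `r'` at sets that are not right cosets of `G` are never used.) -/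
structure CosetWords (f : A → S) (G : Subsemigroup S) where
  e : List A
  r : Set S → List A
  r' : Set S → List A
  e_ne : e ≠ []
  e_val : ∃ x : S, IsIdentityOf G x ∧ val f e = (x : WithOne S)
  r_one : r (G : Set S) = []
  r'_one : r' (G : Set S) = []
  r_ne : ∀ C, IsRightCoset G C → C ≠ (G : Set S) → r C ≠ []
  r'_ne : ∀ C, IsRightCoset G C → C ≠ (G : Set S) → r' C ≠ []
  r_act : ∀ C, IsRightCoset G C → C ≠ (G : Set S) → wordAct f (G : Set S) (r C) = C
  r_r' : ∀ C, IsRightCoset G C → C ≠ (G : Set S) → ∀ g ∈ G,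
    (g : WithOne S) * val f (r C) * val f (r' C) = (g : WithOne S)

variable {f : A → S} {G : Subsemigroup S}

/-- `ψ([i, a]) = e r_i a r'_{ia}`. -/
def psiLetter (c : CosetWords f G) (b : Letter f G) : List A :=
  c.e ++ c.r b.1.1 ++ [b.1.2] ++ c.r' (wordAct f b.1.1 [b.1.2])

/-- The homomorphism `ψ : B* → A*`. -/
def psi (c : CosetWords f G) (w : List (Letter f G)) : List A :=
  w.flatMap (psiLetter c)

/-- The relations `U`: all `φ(i, u) = φ(i, v)` with `(u = v) ∈ R` and `i u ≠ 0`, and all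
`[i, a] = φ(1, e r_i a r'_{ia})`. -/
noncomputable def groupRel (c : CosetWords f G) (R : Set (List A × List A)) :
    Set (List (Letter f G) × List (Letter f G)) :=
  {q | ∃ C, IsRightCoset G C ∧ ∃ r ∈ R, IsRightCoset G (wordAct f C r.1) ∧
      q = (phi f G C r.1, phi f G C r.2)} ∪
    {q | ∃ b : Letter f G, q = ([b], phi f G (G : Set S) (psiLetter c b))}

/-- The path `Λ_w` from `w` to `φ(ψ(w))`, for `w ∈ B⁺`, by recursion on the length:
`Λ_b` is the edge given by the relation `b = φ(ψ(b))`, and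
`Λ_{b w'} = (Λ_b · w') (φ(ψ(b)) · Λ_{w'})`. The value at the empty word is not used. -/
noncomputable def Lam (c : CosetWords f G) : List (Letter f G) → DPath (Letter f G)
  | [] => DPath.nil []
  | [b] => DPath.ofEdge ⟨[], ([b], phi f G (G : Set S) (psiLetter c b)), true, []⟩
  | b :: b' :: w =>
    ((DPath.ofEdge ⟨[], ([b], phi f G (G : Set S) (psiLetter c b)), true, []⟩).act
        [] (b' :: w)).comp
      ((Lam c (b' :: w)).act (phi f G (G : Set S) (psiLetter c b)) [])

/-- The paths `φ(j, P)` for `P ∈ X` and `j (ι P) ≠ 0`. -/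
def setK (f : A → S) (G : Subsemigroup S) (X : Set (DPath A)) : Set (DPath (Letter f G)) :=
  {Q | ∃ P ∈ X, ∃ C, IsRightCoset G C ∧ IsRightCoset G (wordAct f C P.start) ∧
    Q = phiPath f G C P}

/-- The paths `E_r Λ_{r₋₁} φ(1, ψ(E_r))⁻¹ Λ_{r₊₁}⁻¹` for `r ∈ U`, where `E_r = (1, r, +1, 1)`
and `ψ(E_r)` is `psiE r`. -/
def setW (c : CosetWords f G) (R : Set (List A × List A))
    (psiE : List (Letter f G) × List (Letter f G) → DPath A) : Set (DPath (Letter f G)) :=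
  {Q | ∃ r ∈ groupRel c R,
    Q = (((DPath.ofEdge ⟨[], r, true, []⟩).comp (Lam c r.2)).comp
      (phiPath f G (G : Set S) (psiE r)).inv).comp (Lam c r.1).inv}

end Coset

end HomotopyBases

/-!
A word `w ∈ B⁺` is compared with its round trip `φ(ψ(w))`, to which it is connected by the
path `Λ_w`. Along this comparison, everything about `⟨B | U⟩` is read off from `⟨A | R⟩`.

*Presentation.* If `i w = j` then `e r_i w r_j'` represents some `g ∈ G` with `g r_j = e r_i w`
(`CosetWords.exists_mem_mul_r`). By induction on `w`, the word `e ψ(φ(i, w)) r_{iw}` has the same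
value as `e r_i w` (`val_psi_phi`), so `ψ ∘ φ` preserves the values of words representing elements
of `G`. Hence both kinds of relations in `U` hold in `G`, and every element of `G` is the value of
a word over `B`. Conversely, if `u` and `v` have the same value, then `ψ(u)` and `ψ(v)` are
connected in the derivation graph over `A`; applying `φ` and adding the paths `Λ_u`, `Λ_v`
connects `u` to `v`.

*Homotopy base.* Let `∼` be any homotopy relation over `B` that makes `K ∪ W` trivial. The relation
"`φ(i, P) ∼ φ(i, Q)` whenever `i (ι P) ≠ 0`" on parallel paths over `A` is again a homotopy
relation (`isHomotopyRelation_phiPath`), and it makes `X` trivial because `K` is trivial for `∼`.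
As `X` is a homotopy base, `φ(i, -)` sends parallel paths to homotopic ones
(`sim_phiPath_of_parallel`). On the other hand every path `P` over `B` has a lift `T`, a path over
`A` from `ψ(ι P)` to `ψ(τ P)` with `P Λ_{τ P} ∼ Λ_{ι P} φ(T)` (`HasLift.of_isPath`): for the edges
`E_r` this is what `W` says, and the property is preserved by inverses, by the two-sided action of
words (by the interchange law for paths, `IsHomotopyRelation.interchange`, since
`Λ_{uv} = (Λ_u · v)(φ(ψ(u)) · Λ_v)`), and by composition. If `P` and `Q` are parallel then so are
their lifts `T` and `T'`, hence `P Λ ∼ Λ' φ(T) ∼ Λ' φ(T') ∼ Q Λ`, and `Λ` cancels.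
-/

namespace HomotopyBases

/-! ### Paths of the derivation graph -/

section Paths

variable {A : Type*} {R : Set (List A × List A)}

lemma endVertex_append (v : List A) (l l' : List (DEdge A)) :
    endVertex v (l ++ l') = endVertex (endVertex v l) l' := by
  induction l generalizing v with
  | nil => rfl
  | cons E l ih => exact ih E.tgt

lemma isChain_append (v : List A) (l l' : List (DEdge A)) :
    IsChain R v (l ++ l') ↔ IsChain R v l ∧ IsChain R (endVertex v l) l' := by
  induction l generalizing v with
  | nil => simp [IsChain, endVertex]
  | cons E l ih => simp [IsChain, endVertex, ih, and_assoc]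

@[simp] lemma DEdge.src_act (x y : List A) (E : DEdge A) :
    (E.act x y).src = x ++ E.src ++ y := by
  cases h : E.sign <;> simp [DEdge.src, DEdge.act, h]

@[simp] lemma DEdge.tgt_act (x y : List A) (E : DEdge A) :
    (E.act x y).tgt = x ++ E.tgt ++ y := by
  cases h : E.sign <;> simp [DEdge.tgt, DEdge.act, h]

@[simp] lemma DEdge.src_inv (E : DEdge A) : E.inv.src = E.tgt := by
  cases h : E.sign <;> simp [DEdge.src, DEdge.tgt, DEdge.inv, h]

@[simp] lemma DEdge.tgt_inv (E : DEdge A) : E.inv.tgt = E.src := by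
  cases h : E.sign <;> simp [DEdge.src, DEdge.tgt, DEdge.inv, h]

@[simp] lemma DEdge.inv_inv (E : DEdge A) : E.inv.inv = E := by
  simp [DEdge.inv]

lemma endVertex_act (x y v : List A) (l : List (DEdge A)) :
    endVertex (x ++ v ++ y) (l.map fun E => E.act x y) = x ++ endVertex v l ++ y := by
  induction l generalizing v with
  | nil => rfl
  | cons E l ih => simpa [endVertex] using ih E.tgt

lemma IsChain.act {v : List A} {l : List (DEdge A)} (h : IsChain R v l) (x y : List A) :
    IsChain R (x ++ v ++ y) (l.map fun E => E.act x y) := by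
  induction l generalizing v with
  | nil => trivial
  | cons E l ih =>
    obtain ⟨h1, rfl, h3⟩ := h
    exact ⟨h1, E.src_act x y, by simpa using ih h3⟩

lemma IsChain.inv {v : List A} {l : List (DEdge A)} (h : IsChain R v l) :
    IsChain R (endVertex v l) (l.map DEdge.inv).reverse ∧
      endVertex (endVertex v l) (l.map DEdge.inv).reverse = v := by
  induction l generalizing v with
  | nil => exact ⟨trivial, rfl⟩
  | cons E l ih =>
    obtain ⟨h1, rfl, h3⟩ := h
    obtain ⟨ih1, ih2⟩ := ih h3
    simp only [List.map_cons, List.reverse_cons, isChain_append, endVertex_append, endVertex,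
      ih1, ih2, IsChain, DEdge.src_inv, DEdge.tgt_inv, and_true, true_and]
    exact h1

lemma DEdge.tgt_ne_nil (hR : ∀ r ∈ R, r.1 ≠ [] ∧ r.2 ≠ []) {E : DEdge A} (h : E.rule ∈ R) :
    E.tgt ≠ [] := by
  have := hR _ h
  cases hs : E.sign <;> simp [DEdge.tgt, hs, this]

lemma DEdge.src_ne_nil (hR : ∀ r ∈ R, r.1 ≠ [] ∧ r.2 ≠ []) {E : DEdge A} (h : E.rule ∈ R) :
    E.src ≠ [] := by
  rw [← E.tgt_inv]
  exact DEdge.tgt_ne_nil hR h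

lemma IsChain.endVertex_ne_nil (hR : ∀ r ∈ R, r.1 ≠ [] ∧ r.2 ≠ []) {v : List A}
    {l : List (DEdge A)} (h : IsChain R v l) (hv : v ≠ []) : endVertex v l ≠ [] := by
  induction l generalizing v with
  | nil => exact hv
  | cons E l ih => exact ih h.2.2 (DEdge.tgt_ne_nil hR h.1)

lemma IsPath.tgt_ne_nil (hR : ∀ r ∈ R, r.1 ≠ [] ∧ r.2 ≠ []) {P : DPath A} (h : IsPath R P) :
    P.tgt ≠ [] :=
  h.2.endVertex_ne_nil hR h.1

@[simp] lemma DPath.start_comp (P Q : DPath A) : (P.comp Q).start = P.start := rfl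

@[simp] lemma DPath.start_act (x y : List A) (P : DPath A) :
    (P.act x y).start = x ++ P.start ++ y := rfl

@[simp] lemma DPath.start_inv (P : DPath A) : P.inv.start = P.tgt := rfl

@[simp] lemma DPath.start_nil (v : List A) : (DPath.nil v).start = v := rfl

@[simp] lemma DPath.tgt_nil (v : List A) : (DPath.nil v).tgt = v := rfl

@[simp] lemma DPath.start_ofEdge (E : DEdge A) : (DPath.ofEdge E).start = E.src := rfl

@[simp] lemma DPath.tgt_ofEdge (E : DEdge A) : (DPath.ofEdge E).tgt = E.tgt := rfl

@[simp] lemma DPath.tgt_mk_nil (v : List A) : (⟨v, []⟩ : DPath A).tgt = v := rfl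

@[simp] lemma DPath.tgt_mk_cons (v : List A) (E : DEdge A) (l : List (DEdge A)) :
    (⟨v, E :: l⟩ : DPath A).tgt = (⟨E.tgt, l⟩ : DPath A).tgt := rfl

@[simp] lemma DPath.tgt_comp {P Q : DPath A} (h : P.tgt = Q.start) : (P.comp Q).tgt = Q.tgt := by
  unfold DPath.tgt DPath.comp at *
  rw [endVertex_append, h]

@[simp] lemma DPath.tgt_act (x y : List A) (P : DPath A) :
    (P.act x y).tgt = x ++ P.tgt ++ y :=
  endVertex_act x y P.start P.edges

lemma IsPath.tgt_inv {P : DPath A} (h : IsPath R P) : P.inv.tgt = P.start :=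
  h.2.inv.2

lemma DPath.comp_assoc (P Q T : DPath A) : (P.comp Q).comp T = P.comp (Q.comp T) := by
  simp [DPath.comp]

lemma DPath.nil_comp {P : DPath A} {v : List A} (h : v = P.start) :
    (DPath.nil v).comp P = P := by
  subst h
  rfl

@[simp] lemma DPath.comp_nil (P : DPath A) (v : List A) : P.comp (DPath.nil v) = P := by
  simp [DPath.comp, DPath.nil]

lemma DPath.act_comp (x y : List A) (P Q : DPath A) :
    (P.comp Q).act x y = (P.act x y).comp (Q.act x y) := by
  simp [DPath.comp, DPath.act]

lemma DPath.act_act (x y x' y' : List A) (P : DPath A) :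
    (P.act x y).act x' y' = P.act (x' ++ x) (y ++ y') := by
  simp [DPath.act, DEdge.act, Function.comp_def]

@[simp] lemma DPath.act_nil_nil (P : DPath A) : P.act [] [] = P := by
  simp [DPath.act, DEdge.act]

lemma IsPath.inv_inv {P : DPath A} (h : IsPath R P) : P.inv.inv = P := by
  obtain ⟨v, l⟩ := P
  simp only [DPath.inv, DPath.tgt, DPath.mk.injEq]
  exact ⟨h.2.inv.2, by simp [List.map_reverse, Function.comp_def]⟩

lemma isPath_nil {v : List A} (h : v ≠ []) : IsPath R (DPath.nil v) := ⟨h, trivial⟩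

lemma isPath_ofEdge (hR : ∀ r ∈ R, r.1 ≠ [] ∧ r.2 ≠ []) {E : DEdge A} (h : E.rule ∈ R) :
    IsPath R (DPath.ofEdge E) :=
  ⟨DEdge.src_ne_nil hR h, h, rfl, trivial⟩

lemma IsPath.comp {P Q : DPath A} (hP : IsPath R P) (hQ : IsPath R Q) (h : P.tgt = Q.start) :
    IsPath R (P.comp Q) := by
  refine ⟨hP.1, ?_⟩
  simp only [DPath.comp, isChain_append]
  refine ⟨hP.2, ?_⟩
  have := hQ.2
  rwa [← h] at this

lemma IsPath.act {P : DPath A} (hP : IsPath R P) (x y : List A) : IsPath R (P.act x y) :=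
  ⟨by simp [DPath.act, hP.1], hP.2.act x y⟩

lemma IsPath.inv (hR : ∀ r ∈ R, r.1 ≠ [] ∧ r.2 ≠ []) {P : DPath A} (hP : IsPath R P) :
    IsPath R P.inv :=
  ⟨hP.tgt_ne_nil hR, hP.2.inv.1⟩

lemma IsChain.eqvGen_step {v : List A} {l : List (DEdge A)} (h : IsChain R v l) :
    Relation.EqvGen (Step R) v (endVertex v l) := by
  induction l generalizing v with
  | nil => exact .refl _
  | cons E l ih =>
    obtain ⟨h1, rfl, h3⟩ := h
    refine .trans _ _ _ ?_ (ih h3)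
    cases hs : E.sign
    · exact .symm _ _ (.rel _ _ ⟨E.rule, h1, E.left, E.right, by simp [DEdge.tgt, hs],
        by simp [DEdge.src, hs]⟩)
    · exact .rel _ _ ⟨E.rule, h1, E.left, E.right, by simp [DEdge.src, hs],
        by simp [DEdge.tgt, hs]⟩

end Paths

/-! ### Homotopy relations -/

section Homotopy

variable {A : Type*} {R : Set (List A × List A)}

lemma parallel_isHomotopyRelation (hR : ∀ r ∈ R, r.1 ≠ [] ∧ r.2 ≠ []) :
    IsHomotopyRelation R (Parallel R) where
  parallel _ _ h := h
  refl _ h := ⟨h, h, rfl, rfl⟩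
  symm _ _ h := ⟨h.2.1, h.1, h.2.2.1.symm, h.2.2.2.symm⟩
  trans _ _ _ h h' := ⟨h.1, h'.2.1, h.2.2.1.trans h'.2.2.1, h.2.2.2.trans h'.2.2.2⟩
  h1 E₁ E₂ h₁ h₂ := by
    have p₁ := isPath_ofEdge hR h₁
    have p₂ := isPath_ofEdge hR h₂
    have e₁ : ((DPath.ofEdge E₁).act [] E₂.src).tgt =
        ((DPath.ofEdge E₂).act E₁.tgt []).start := by simp
    have e₂ : ((DPath.ofEdge E₂).act E₁.src []).tgt =
        ((DPath.ofEdge E₁).act [] E₂.tgt).start := by simp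
    refine ⟨(p₁.act _ _).comp (p₂.act _ _) e₁, (p₂.act _ _).comp (p₁.act _ _) e₂, by simp, ?_⟩
    rw [DPath.tgt_comp e₁, DPath.tgt_comp e₂]
    simp
  h2 P Q h x y := ⟨h.1.act x y, h.2.1.act x y, by simp [h.2.2.1], by simp [h.2.2.2]⟩
  h3 P Q T T' h hT hT' e e' := by
    have e₂ : T.tgt = Q.start := e.trans h.2.2.1
    have a₁ : (T.comp P).tgt = T'.start := by rw [DPath.tgt_comp e, e']
    have a₂ : (T.comp Q).tgt = T'.start := by rw [DPath.tgt_comp e₂, e', h.2.2.2]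
    exact ⟨(hT.comp h.1 e).comp hT' a₁, (hT.comp h.2.1 e₂).comp hT' a₂, rfl, by
      rw [DPath.tgt_comp a₁, DPath.tgt_comp a₂]⟩
  h4 P h := by
    have e : P.tgt = P.inv.start := rfl
    exact ⟨h.comp (h.inv hR) e, isPath_nil h.1, rfl, by rw [DPath.tgt_comp e, h.tgt_inv]; rfl⟩

namespace IsHomotopyRelation

variable {sim : DPath A → DPath A → Prop} (H : IsHomotopyRelation R sim)
include H

lemma comp_right {P Q T : DPath A} (h : sim P Q) (hT : IsPath R T) (e : P.tgt = T.start) :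
    sim (P.comp T) (Q.comp T) := by
  have hp := H.parallel _ _ h
  have := H.h3 _ _ (DPath.nil P.start) T h (isPath_nil hp.1.1) hT rfl e.symm
  rwa [DPath.nil_comp rfl, DPath.nil_comp hp.2.2.1] at this

lemma comp_left (hR : ∀ r ∈ R, r.1 ≠ [] ∧ r.2 ≠ []) {P Q T : DPath A} (h : sim P Q)
    (hT : IsPath R T) (e : T.tgt = P.start) : sim (T.comp P) (T.comp Q) := by
  have hp := H.parallel _ _ h
  have := H.h3 _ _ T (DPath.nil P.tgt) h hT (isPath_nil (hp.1.tgt_ne_nil hR)) e rfl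
  rwa [DPath.comp_nil, DPath.comp_nil] at this

lemma inv_comp (hR : ∀ r ∈ R, r.1 ≠ [] ∧ r.2 ≠ []) {P : DPath A} (h : IsPath R P) :
    sim (P.inv.comp P) (DPath.nil P.tgt) := by
  have := H.h4 P.inv (h.inv hR)
  rwa [h.inv_inv] at this

lemma cancel_right (hR : ∀ r ∈ R, r.1 ≠ [] ∧ r.2 ≠ []) {P Q T : DPath A} (hP : IsPath R P)
    (hQ : IsPath R Q) (hT : IsPath R T) (eP : P.tgt = T.start) (eQ : Q.tgt = T.start)
    (h : sim (P.comp T) (Q.comp T)) : sim P Q := by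
  have key : ∀ {P : DPath A}, IsPath R P → P.tgt = T.start → sim ((P.comp T).comp T.inv) P := by
    intro P hP eP
    have := H.comp_left hR (H.h4 T hT) hP eP
    rwa [← DPath.comp_assoc, DPath.comp_nil] at this
  have := H.comp_right h (hT.inv hR) (DPath.tgt_comp eP)
  exact H.trans _ _ _ (H.symm _ _ (key hP eP)) (H.trans _ _ _ this (key hQ eQ))

/-- The interchange law (H1) for a path and an edge. The path may be the empty path at the empty
word, which is not a vertex. -/
lemma interchange_edge (hR : ∀ r ∈ R, r.1 ≠ [] ∧ r.2 ≠ []) {P : DPath A}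
    (hP : IsChain R P.start P.edges) {E : DEdge A} (hE : E.rule ∈ R) :
    sim ((P.act [] E.src).comp ((DPath.ofEdge E).act P.tgt []))
      (((DPath.ofEdge E).act P.start []).comp (P.act [] E.tgt)) := by
  obtain ⟨v, l⟩ := P
  have pE := isPath_ofEdge hR hE
  induction l generalizing v with
  | nil =>
    have : ((DPath.ofEdge E).act v []).comp ((⟨v, []⟩ : DPath A).act [] E.tgt) =
        (DPath.ofEdge E).act v [] := by simp [DPath.act, DPath.comp]
    rw [this]
    convert H.refl _ (pE.act v []) using 1
    simp [DPath.act, DPath.comp, DPath.ofEdge]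
  | cons F l ih =>
    obtain ⟨h1, rfl, h3⟩ := hP
    have ih := ih F.tgt h3
    have pF := isPath_ofEdge hR h1
    have pL : IsPath R ⟨F.tgt, l⟩ := ⟨DEdge.tgt_ne_nil hR h1, h3⟩
    -- `E` is moved first past the tail `l`, then past the edge `F`.
    have s₁ := H.comp_left hR ih (pF.act [] E.src) (by simp)
    have s₂ := H.comp_right (H.h1 F E h1 hE) (pL.act [] E.tgt) (by simp)
    rw [← DPath.comp_assoc] at s₁
    have s := H.trans _ _ _ s₁ (by rw [← DPath.comp_assoc]; exact s₂)
    convert s using 1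
    · simp [DPath.act, DPath.comp, DPath.ofEdge]
    · simp [DPath.act, DPath.comp, DPath.ofEdge]

/-- The interchange law (H1) for paths. Either path may be the empty path at the empty word,
which is not a vertex, but not both; this covers the paths `Λ_w` with `w` empty. -/
lemma interchange (hR : ∀ r ∈ R, r.1 ≠ [] ∧ r.2 ≠ []) {P Q : DPath A}
    (hP : IsChain R P.start P.edges) (hQ : IsChain R Q.start Q.edges)
    (hne : P.start ++ Q.start ≠ []) :
    sim ((P.act [] Q.start).comp (Q.act P.tgt []))
      ((Q.act P.start []).comp (P.act [] Q.tgt)) := by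
  obtain ⟨w, m⟩ := Q
  induction m generalizing w with
  | nil =>
    have pP : IsPath R (P.act [] w) := ⟨by simpa [DPath.act] using hne, hP.act [] w⟩
    convert H.refl _ pP using 1
    · simp [DPath.act, DPath.comp]
    · simp [DPath.act, DPath.comp]
  | cons F m ih =>
    obtain ⟨h1, rfl, h3⟩ := hQ
    have tne := DEdge.tgt_ne_nil hR h1
    have ih := ih F.tgt h3 (by simp [tne])
    have pF := isPath_ofEdge hR h1
    have pM : IsPath R ⟨F.tgt, m⟩ := ⟨tne, h3⟩
    have s₁ := H.comp_left hR ih (pF.act P.start []) (by simp)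
    have s₂ := H.comp_right (H.interchange_edge hR hP h1) (pM.act P.tgt []) (by simp)
    rw [← DPath.comp_assoc] at s₁
    have s := H.trans _ _ _ s₂ s₁
    convert s using 1
    · simp [DPath.act, DPath.comp, DPath.ofEdge]
    · simp [DPath.act, DPath.comp, DPath.ofEdge]

end IsHomotopyRelation

end Homotopy

/-! ### The action of words on the right cosets -/

section Coset

variable {A S : Type*} [Semigroup S] {f : A → S} {G : Subsemigroup S}

@[simp] lemma val_nil : val f ([] : List A) = 1 := rfl

@[simp] lemma val_cons (a : A) (w : List A) : val f (a :: w) = (f a : WithOne S) * val f w := by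
  simp [val]

@[simp] lemma val_append (u v : List A) : val f (u ++ v) = val f u * val f v := by
  simp [val]

lemma exists_coe_eq_coe_mul (s : S) (x : WithOne S) : ∃ t : S, (t : WithOne S) = s * x := by
  induction x using WithOne.recOneCoe with
  | one => exact ⟨s, by simp⟩
  | coe a => exact ⟨s * a, by simp⟩

lemma exists_coe_eq_val {w : List A} (h : w ≠ []) : ∃ t : S, (t : WithOne S) = val f w := by
  cases w with
  | nil => exact absurd rfl h
  | cons a w => simpa using exists_coe_eq_coe_mul (f a) (val f w)

@[simp] lemma wordAct_nil (C : Set S) : wordAct f C [] = C := by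
  ext t
  simp [wordAct]

lemma wordAct_append (C : Set S) (u v : List A) :
    wordAct f C (u ++ v) = wordAct f (wordAct f C u) v := by
  ext t
  simp only [wordAct, Set.mem_ofPred_eq, val_append, ← mul_assoc]
  constructor
  · rintro ⟨c, hc, h⟩
    obtain ⟨d, hd⟩ := exists_coe_eq_coe_mul c (val f u)
    exact ⟨d, ⟨c, hc, hd⟩, by rw [hd, h]⟩
  · rintro ⟨d, ⟨c, hc, hd⟩, h⟩
    exact ⟨c, hc, by rw [← hd, h]⟩

lemma wordAct_congr (C : Set S) {u v : List A} (h : val f u = val f v) :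
    wordAct f C u = wordAct f C v := by
  simp [wordAct, h]

lemma wordAct_of_val {C : Set S} {w : List A} {s : S} (h : val f w = s) :
    wordAct f C w = (fun x => x * s) '' C := by
  ext t
  simp only [wordAct, h, Set.mem_ofPred_eq, Set.mem_image, ← WithOne.coe_mul, WithOne.coe_inj]
  exact ⟨fun ⟨c, hc, e⟩ => ⟨c, hc, e.symm⟩, fun ⟨c, hc, e⟩ => ⟨c, hc, e.symm⟩⟩

/-- `C` is a right coset `C_i` of `G`, and `i w ≠ 0`: the condition under which `φ(i, w)` is
meaningful. -/
abbrev Admissible (f : A → S) (G : Subsemigroup S) (C : Set S) (w : List A) : Prop :=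
  IsRightCoset G C ∧ IsRightCoset G (wordAct f C w)

lemma image_mul_of_mem (hG : IsSubgroup G) {g : S} (hg : g ∈ G) :
    (fun x => x * g) '' (G : Set S) = G := by
  obtain ⟨x, ⟨-, hx⟩, hinv⟩ := hG
  ext t
  constructor
  · rintro ⟨y, hy, rfl⟩
    exact G.mul_mem hy hg
  · intro ht
    obtain ⟨k, hk, -, hk'⟩ := hinv g hg
    exact ⟨t * k, G.mul_mem ht hk, by simp only [mul_assoc, hk', (hx t ht).2]⟩

lemma isRightCoset_self (hG : IsSubgroup G) : IsRightCoset G (G : Set S) := by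
  obtain ⟨x, hx, -⟩ := id hG
  exact ⟨x, (image_mul_of_mem hG hx.1).symm, x, image_mul_of_mem hG hx.1⟩

lemma wordAct_of_mem (hG : IsSubgroup G) {w : List A} {g : S} (hg : g ∈ G) (h : val f w = g) :
    wordAct f (G : Set S) w = G := by
  rw [wordAct_of_val h, image_mul_of_mem hG hg]

/-- If `i u v ≠ 0` then `i u ≠ 0`: if `(G s u v) s' = G`, then `v s'` takes `G s u` back to `G`. -/
lemma Admissible.left {C : Set S} {u v : List A} (h : Admissible f G C (u ++ v)) :
    Admissible f G C u := by
  refine ⟨h.1, ?_⟩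
  have h2 := h.2
  rcases eq_or_ne v [] with rfl | hv
  · simpa using h2
  rcases eq_or_ne u [] with rfl | hu
  · simpa using h.1
  rw [wordAct_append] at h2
  obtain ⟨a, ha⟩ := exists_coe_eq_val (f := f) hu
  obtain ⟨b, hb⟩ := exists_coe_eq_val (f := f) hv
  obtain ⟨-, -, s', hs'⟩ := h2
  obtain ⟨s, hC, -⟩ := h.1
  refine ⟨s * a, ?_, b * s', ?_⟩
  · rw [wordAct_of_val ha.symm, hC, Set.image_image]
    simp [mul_assoc]
  · rw [← hs', wordAct_of_val hb.symm, Set.image_image]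
    simp [mul_assoc]

lemma Admissible.right {C : Set S} {u v : List A} (h : Admissible f G C (u ++ v)) :
    Admissible f G (wordAct f C u) v :=
  ⟨h.left.2, by rw [← wordAct_append]; exact h.2⟩

lemma Admissible.congr {C : Set S} {u v : List A} (h : Admissible f G C u)
    (e : val f u = val f v) : Admissible f G C v :=
  ⟨h.1, by rw [← wordAct_congr C e]; exact h.2⟩

/-! ### The rewriting map `φ` on words and paths -/

@[simp] lemma phi_nil (C : Set S) : phi f G C [] = [] := rfl

lemma phi_cons {C : Set S} {a : A} {w : List A} (h : Admissible f G C [a]) :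
    phi f G C (a :: w) = ⟨(C, a), h⟩ :: phi f G (wordAct f C [a]) w := by
  rw [phi, dif_pos h]

lemma phi_append {C : Set S} {u v : List A} (h : Admissible f G C (u ++ v)) :
    phi f G C (u ++ v) = phi f G C u ++ phi f G (wordAct f C u) v := by
  induction u generalizing C with
  | nil => simp
  | cons a u ih =>
    have h' : Admissible f G C ([a] ++ (u ++ v)) := h
    rw [List.cons_append, phi_cons h'.left, phi_cons h'.left, ih h'.right, ← wordAct_append]
    rfl

lemma phi_ne_nil {C : Set S} {w : List A} (h : Admissible f G C w) (hw : w ≠ []) :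
    phi f G C w ≠ [] := by
  cases w with
  | nil => exact absurd rfl hw
  | cons a w =>
    have h' : Admissible f G C ([a] ++ w) := h
    simp [phi_cons h'.left]

variable {R : Set (List A × List A)}

lemma DEdge.val_src_eq_val_tgt (hv : ∀ r ∈ R, val f r.1 = val f r.2) {E : DEdge A}
    (hE : E.rule ∈ R) : val f E.src = val f E.tgt := by
  have := hv _ hE
  cases hs : E.sign <;> simp [DEdge.src, DEdge.tgt, hs, this]

lemma val_eq_of_eqvGen (hv : ∀ r ∈ R, val f r.1 = val f r.2) {u v : List A}
    (h : Relation.EqvGen (Step R) u v) : val f u = val f v := by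
  induction h with
  | rel _ _ h =>
    obtain ⟨r, hr, w₁, w₂, rfl, rfl⟩ := h
    simp [hv r hr]
  | refl => rfl
  | symm _ _ _ ih => exact ih.symm
  | trans _ _ _ _ _ ih ih' => exact ih.trans ih'

lemma val_endVertex (hv : ∀ r ∈ R, val f r.1 = val f r.2) {v : List A} {l : List (DEdge A)}
    (h : IsChain R v l) : val f v = val f (endVertex v l) :=
  val_eq_of_eqvGen hv h.eqvGen_step

/-- If `i (ι E) ≠ 0` then also `i (w₁ r_ε w₂) ≠ 0` for both signs `ε`; this form does not
depend on the sign of `E = (w₁, r, ε, w₂)`. -/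
lemma admissible_factors (hv : ∀ r ∈ R, val f r.1 = val f r.2) {C : Set S} {E : DEdge A}
    (hE : E.rule ∈ R) (h : Admissible f G C E.src) :
    Admissible f G C (E.left ++ E.rule.1 ++ E.right) ∧
      Admissible f G C (E.left ++ E.rule.2 ++ E.right) := by
  have h1 := h
  have h2 := h.congr (E.val_src_eq_val_tgt hv hE)
  cases hs : E.sign
  · simp only [DEdge.src, DEdge.tgt, hs] at h1 h2
    exact ⟨h2, h1⟩
  · simp only [DEdge.src, DEdge.tgt, hs] at h1 h2
    exact ⟨h1, h2⟩

lemma phiEdge_src_tgt (hv : ∀ r ∈ R, val f r.1 = val f r.2) {C : Set S} {E : DEdge A}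
    (hE : E.rule ∈ R) (h : Admissible f G C E.src) :
    (phiEdge f G C E).src = phi f G C E.src ∧ (phiEdge f G C E).tgt = phi f G C E.tgt := by
  obtain ⟨h1, h2⟩ := admissible_factors hv hE h
  have e : wordAct f C (E.left ++ E.rule.1) = wordAct f C (E.left ++ E.rule.2) :=
    wordAct_congr C (by simp [hv _ hE])
  have p1 := phi_append h1
  have p2 := phi_append h2
  rw [phi_append h1.left] at p1
  rw [phi_append h2.left, ← e] at p2
  cases hs : E.sign <;> simp [DEdge.src, DEdge.tgt, phiEdge, hs] <;>
    simp [p1, p2, ← List.append_assoc]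

lemma phiEdge_rule_mem (hv : ∀ r ∈ R, val f r.1 = val f r.2) (c : CosetWords f G) {C : Set S}
    {E : DEdge A} (hE : E.rule ∈ R) (h : Admissible f G C E.src) :
    (phiEdge f G C E).rule ∈ groupRel c R := by
  have h1 := (admissible_factors hv hE h).1.left.right
  exact Or.inl ⟨_, h1.1, E.rule, hE, h1.2, rfl⟩

lemma phiEdge_act (hv : ∀ r ∈ R, val f r.1 = val f r.2) {C : Set S} {E : DEdge A} {x y : List A}
    (hE : E.rule ∈ R) (h : Admissible f G C (x ++ E.src ++ y)) :
    phiEdge f G C (E.act x y) = (phiEdge f G (wordAct f C x) E).act (phi f G C x)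
      (phi f G (wordAct f C (x ++ E.src)) y) := by
  have hE' : (E.act x y).rule ∈ R := hE
  obtain ⟨h1, -⟩ := admissible_factors hv hE' (by simpa using h)
  have h3 : Admissible f G C (x ++ E.left ++ E.rule.1 ++ (E.right ++ y)) := h1
  have hl := phi_append h3.left.left
  have hr := phi_append h3.right
  have e : val f (E.left ++ E.rule.1 ++ E.right) = val f E.src := by
    cases hs : E.sign <;> simp [DEdge.src, hs, hv _ hE]
  have e' : wordAct f C (x ++ E.src) = wordAct f C (x ++ E.left ++ E.rule.1 ++ E.right) :=
    wordAct_congr C (by rw [val_append, ← e]; simp)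
  rw [e']
  rw [← wordAct_append] at hr
  simp only [DEdge.act, phiEdge, hl, ← wordAct_append, ← List.append_assoc, hr]

lemma phiPath_chain (hv : ∀ r ∈ R, val f r.1 = val f r.2) (c : CosetWords f G) {C : Set S}
    {v : List A} {l : List (DEdge A)} (h : IsChain R v l) (hC : Admissible f G C v) :
    IsChain (groupRel c R) (phi f G C v) (l.map (phiEdge f G C)) ∧
      endVertex (phi f G C v) (l.map (phiEdge f G C)) = phi f G C (endVertex v l) := by
  induction l generalizing v with
  | nil => exact ⟨trivial, rfl⟩
  | cons E l ih =>
    obtain ⟨h1, rfl, h3⟩ := h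
    obtain ⟨s, t⟩ := phiEdge_src_tgt hv h1 hC
    obtain ⟨i1, i2⟩ := ih h3 (hC.congr (E.val_src_eq_val_tgt hv h1))
    rw [← t] at i1 i2
    exact ⟨⟨phiEdge_rule_mem hv c h1 hC, s, i1⟩, i2⟩

lemma isPath_phiPath (hv : ∀ r ∈ R, val f r.1 = val f r.2) (c : CosetWords f G) {C : Set S}
    {P : DPath A} (h : IsPath R P) (hC : Admissible f G C P.start) :
    IsPath (groupRel c R) (phiPath f G C P) :=
  ⟨phi_ne_nil hC h.1, (phiPath_chain hv c h.2 hC).1⟩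

lemma tgt_phiPath (hv : ∀ r ∈ R, val f r.1 = val f r.2) (c : CosetWords f G) {C : Set S}
    {P : DPath A} (h : IsPath R P) (hC : Admissible f G C P.start) :
    (phiPath f G C P).tgt = phi f G C P.tgt :=
  (phiPath_chain hv c h.2 hC).2

@[simp] lemma start_phiPath (C : Set S) (P : DPath A) :
    (phiPath f G C P).start = phi f G C P.start := rfl

lemma phiPath_comp (C : Set S) (P Q : DPath A) :
    phiPath f G C (P.comp Q) = (phiPath f G C P).comp (phiPath f G C Q) := by
  simp [phiPath, DPath.comp]

lemma phiPath_inv (hv : ∀ r ∈ R, val f r.1 = val f r.2) (c : CosetWords f G) {C : Set S}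
    {P : DPath A} (h : IsPath R P) (hC : Admissible f G C P.start) :
    phiPath f G C P.inv = (phiPath f G C P).inv := by
  rw [DPath.inv, DPath.inv, tgt_phiPath hv c h hC]
  simp [phiPath, List.map_reverse, Function.comp_def, phiEdge, DEdge.inv]

lemma phiPath_act (hv : ∀ r ∈ R, val f r.1 = val f r.2) {C : Set S} {P : DPath A}
    {x y : List A} (h : IsPath R P) (hC : Admissible f G C (x ++ P.start ++ y)) :
    phiPath f G C (P.act x y) = (phiPath f G (wordAct f C x) P).act (phi f G C x)
      (phi f G (wordAct f C (x ++ P.start)) y) := by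
  obtain ⟨v, l⟩ := P
  have key : ∀ (v : List A) (l : List (DEdge A)), IsChain R v l →
      Admissible f G C (x ++ v ++ y) →
      (l.map fun E => E.act x y).map (phiEdge f G C) =
        (l.map (phiEdge f G (wordAct f C x))).map fun E =>
          E.act (phi f G C x) (phi f G (wordAct f C (x ++ v)) y) := by
    intro v l
    induction l generalizing v with
    | nil => exact fun _ _ => rfl
    | cons E l ih =>
      rintro ⟨h1, rfl, h3⟩ ha
      have e := E.val_src_eq_val_tgt hv h1
      have ih := ih _ h3 (ha.congr (by simp [e]))
      have e' : wordAct f C (x ++ E.tgt) = wordAct f C (x ++ E.src) :=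
        wordAct_congr C (by simp [e])
      rw [e'] at ih
      simp only [List.map_cons, ih, phiEdge_act hv h1 ha]
  have hs : phi f G C (x ++ v ++ y) =
      phi f G C x ++ phi f G (wordAct f C x) v ++ phi f G (wordAct f C (x ++ v)) y := by
    rw [phi_append hC, phi_append hC.left]
  simp only [phiPath, DPath.act, key v l h.2 hC, hs]

lemma eqvGen_phi (hv : ∀ r ∈ R, val f r.1 = val f r.2) (c : CosetWords f G) {u v : List A}
    (h : Relation.EqvGen (Step R) u v) {C : Set S} (hC : Admissible f G C u) :
    Relation.EqvGen (Step (groupRel c R)) (phi f G C u) (phi f G C v) := by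
  induction h with
  | rel u v h =>
    obtain ⟨r, hr, w₁, w₂, rfl, rfl⟩ := h
    have ch : IsChain R (w₁ ++ r.1 ++ w₂) [⟨w₁, r, true, w₂⟩] := ⟨hr, rfl, trivial⟩
    obtain ⟨c1, c2⟩ := phiPath_chain hv c ch hC
    have := c1.eqvGen_step
    rwa [c2] at this
  | refl => exact .refl _
  | symm _ _ h ih => exact (ih (hC.congr (val_eq_of_eqvGen hv h).symm)).symm
  | trans _ _ _ h _ ih ih' => exact (ih hC).trans _ _ _ (ih' (hC.congr (val_eq_of_eqvGen hv h)))

/-! ### The values of the words `ψ(w)` -/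

variable (hG : IsSubgroup G) (c : CosetWords f G)

lemma CosetWords.wordAct_r {C : Set S} (hC : IsRightCoset G C) :
    wordAct f (G : Set S) (c.r C) = C := by
  by_cases h : C = G
  · rw [h, c.r_one, wordAct_nil]
  · exact c.r_act C hC h

lemma CosetWords.mul_r_r' {C : Set S} (hC : IsRightCoset G C) {g : S} (hg : g ∈ G) :
    (g : WithOne S) * val f (c.r C) * val f (c.r' C) = g := by
  by_cases h : C = G
  · simp [h, c.r_one, c.r'_one]
  · exact c.r_r' C hC h g hg

lemma CosetWords.e_mul {g : S} (hg : g ∈ G) :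
    val f c.e * (g : WithOne S) = g ∧ (g : WithOne S) * val f c.e = g := by
  obtain ⟨x, hx, e⟩ := c.e_val
  rw [e, ← WithOne.coe_mul, ← WithOne.coe_mul, (hx.2 g hg).1, (hx.2 g hg).2]
  exact ⟨rfl, rfl⟩

/-- If `i w = j` then `e r_i w r_j'` represents an element `g` of `G`, and `g r_j = e r_i w`
in `S`. -/
lemma CosetWords.exists_mem_mul_r {C : Set S} {w : List A} (h : Admissible f G C w) :
    ∃ g ∈ G, (g : WithOne S) = val f (c.e ++ c.r C ++ w ++ c.r' (wordAct f C w)) ∧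
      (g : WithOne S) * val f (c.r (wordAct f C w)) = val f c.e * val f (c.r C) * val f w := by
  obtain ⟨x, hx, e⟩ := id c.e_val
  obtain ⟨s, hs⟩ := exists_coe_eq_coe_mul x (val f (c.r C) * val f w)
  have hm : s ∈ wordAct f (wordAct f (G : Set S) (c.r C)) w := by
    rw [← wordAct_append]
    exact ⟨x, hx.1, by simpa using hs⟩
  rw [c.wordAct_r h.1, ← c.wordAct_r h.2] at hm
  obtain ⟨g, hg, hgs⟩ := hm
  have key : (g : WithOne S) * val f (c.r (wordAct f C w)) =
      val f c.e * val f (c.r C) * val f w := by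
    rw [← hgs, hs, e, mul_assoc]
  refine ⟨g, hg, ?_, key⟩
  rw [val_append, val_append, val_append, ← key, c.mul_r_r' h.2 hg]

lemma val_psiLetter (b : Letter f G) :
    ∃ g ∈ G, (g : WithOne S) = val f (psiLetter c b) ∧
      (g : WithOne S) * val f (c.r (wordAct f b.1.1 [b.1.2])) =
        val f c.e * val f (c.r b.1.1) * val f [b.1.2] :=
  c.exists_mem_mul_r b.2

@[simp] lemma psi_nil : psi c [] = [] := rfl

@[simp] lemma psi_cons (b : Letter f G) (w : List (Letter f G)) :
    psi c (b :: w) = psiLetter c b ++ psi c w := rfl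

lemma psi_append (u v : List (Letter f G)) : psi c (u ++ v) = psi c u ++ psi c v := by
  simp [psi]

lemma psiLetter_ne_nil (b : Letter f G) : psiLetter c b ≠ [] := by
  simp [psiLetter]

lemma psi_ne_nil {w : List (Letter f G)} (h : w ≠ []) : psi c w ≠ [] := by
  cases w with
  | nil => exact absurd rfl h
  | cons b w => simp [psiLetter_ne_nil]

lemma exists_mem_val_psi {w : List (Letter f G)} (h : w ≠ []) :
    ∃ g ∈ G, (g : WithOne S) = val f (psi c w) := by
  induction w with
  | nil => exact absurd rfl h
  | cons b w ih =>
    obtain ⟨g, hg, e, -⟩ := val_psiLetter c b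
    rcases eq_or_ne w [] with rfl | hw
    · exact ⟨g, hg, by simp [e]⟩
    · obtain ⟨k, hk, e'⟩ := ih hw
      exact ⟨g * k, G.mul_mem hg hk, by simp [e, e']⟩

include hG

lemma wordAct_psi (w : List (Letter f G)) : wordAct f (G : Set S) (psi c w) = G := by
  rcases eq_or_ne w [] with rfl | hw
  · simp
  · obtain ⟨g, hg, e⟩ := exists_mem_val_psi c hw
    exact wordAct_of_mem hG hg e.symm

lemma admissible_psi (w : List (Letter f G)) : Admissible f G (G : Set S) (psi c w) :=
  ⟨isRightCoset_self hG, by rw [wordAct_psi hG]; exact isRightCoset_self hG⟩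

lemma phi_psi_append (u v : List (Letter f G)) :
    phi f G (G : Set S) (psi c (u ++ v)) =
      phi f G (G : Set S) (psi c u) ++ phi f G (G : Set S) (psi c v) := by
  have h := admissible_psi hG c (u ++ v)
  rw [psi_append] at h ⊢
  rw [phi_append h, wordAct_psi hG]

omit hG in
/-- The word `e ψ(φ(i, w)) r_{iw}` represents the same element of `S` as `e r_i w`. -/
lemma val_psi_phi {C : Set S} {w : List A} (h : Admissible f G C w) :
    val f c.e * val f (psi c (phi f G C w)) * val f (c.r (wordAct f C w)) =
      val f c.e * val f (c.r C) * val f w := by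
  induction w generalizing C with
  | nil => simp
  | cons a w ih =>
    have h' : Admissible f G C ([a] ++ w) := h
    obtain ⟨g, hg, e, e'⟩ := val_psiLetter c ⟨(C, a), h'.left⟩
    have ih := ih h'.right
    rw [← wordAct_append] at ih
    obtain ⟨h1, h2⟩ := c.e_mul hg
    rw [phi_cons h'.left, psi_cons, val_append, ← e, ← mul_assoc, h1]
    change _ * val f (c.r (wordAct f C ([a] ++ w))) = _ * val f ([a] ++ w)
    rw [val_append, ← mul_assoc, ← e']
    calc _ = (g : WithOne S) * val f c.e * val f (psi c (phi f G (wordAct f C [a]) w)) *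
          val f (c.r (wordAct f C ([a] ++ w))) := by rw [h2]
      _ = (g : WithOne S) * (val f c.e * val f (c.r (wordAct f C [a])) * val f w) := by
          rw [← ih]
          simp only [mul_assoc]
      _ = (g : WithOne S) * val f c.e * val f (c.r (wordAct f C [a])) * val f w := by
          simp only [mul_assoc]
      _ = _ := by rw [h2]

/-- If `w` represents an element of `G`, then `ψ(φ(w))` represents the same element. -/
lemma val_psi_phi_of_mem {w : List A} {g : S} (hg : g ∈ G) (h : val f w = g) :
    val f (psi c (phi f G (G : Set S) w)) = g := by
  have hw : wordAct f (G : Set S) w = G := wordAct_of_mem hG hg h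
  have ha : Admissible f G (G : Set S) w :=
    ⟨isRightCoset_self hG, by rw [hw]; exact isRightCoset_self hG⟩
  have h0 : w ≠ [] := by
    rintro rfl
    exact WithOne.one_ne_coe h
  obtain ⟨k, hk, e⟩ := exists_mem_val_psi c (phi_ne_nil ha h0)
  have := val_psi_phi c ha
  rw [hw, c.r_one, h, ← e] at this
  simp only [val_nil, mul_one, (c.e_mul hk).1, (c.e_mul hg).1] at this
  rw [← e, this]

omit hG in
/-- Words with the same value have images under `ψ ∘ φ(i, -)` with the same value. -/
lemma val_psi_phi_congr {C : Set S} {u v : List A} (hu : Admissible f G C u) (hu0 : u ≠ [])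
    (hv0 : v ≠ []) (h : val f u = val f v) :
    val f (psi c (phi f G C u)) = val f (psi c (phi f G C v)) := by
  have hv := hu.congr h
  obtain ⟨k, hk, e⟩ := exists_mem_val_psi c (phi_ne_nil hu hu0)
  obtain ⟨l, hl, e'⟩ := exists_mem_val_psi c (phi_ne_nil hv hv0)
  have := (val_psi_phi c hu).trans ((congrArg _ h).trans (val_psi_phi c hv).symm)
  rw [← e, ← e', (c.e_mul hk).1, (c.e_mul hl).1, ← wordAct_congr C h] at this
  rw [← e, ← e', ← c.mul_r_r' hu.2 hk, this, c.mul_r_r' hu.2 hl]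

end Coset

section Coset

variable {A S : Type*} [Semigroup S] {f : A → S} {G : Subsemigroup S}
variable {R : Set (List A × List A)}

/-! ### The paths `Λ_w` -/

section Lam

lemma groupRel_ne_nil (hR : ∀ r ∈ R, r.1 ≠ [] ∧ r.2 ≠ []) (hv : ∀ r ∈ R, val f r.1 = val f r.2)
    (hG : IsSubgroup G) (c : CosetWords f G) :
    ∀ r ∈ groupRel c R, r.1 ≠ [] ∧ r.2 ≠ [] := by
  rintro _ (⟨C, hC, r, hr, hCr, rfl⟩ | ⟨b, rfl⟩)
  · have ha : Admissible f G C r.1 := ⟨hC, hCr⟩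
    exact ⟨phi_ne_nil ha (hR r hr).1, phi_ne_nil (ha.congr (hv r hr)) (hR r hr).2⟩
  · have ha := admissible_psi hG c [b]
    simp only [psi_cons, psi_nil, List.append_nil] at ha
    exact ⟨by simp, phi_ne_nil ha (psiLetter_ne_nil c b)⟩

variable (hG : IsSubgroup G) (c : CosetWords f G)

/-- The recursion for `Λ` also holds for a single letter, since `Lam` has the empty path at the empty
word as its value there; so no separate case is needed for words of length one. -/
lemma Lam_cons (b : Letter f G) (w : List (Letter f G)) :
    Lam c (b :: w) =
      ((DPath.ofEdge ⟨[], ([b], phi f G (G : Set S) (psiLetter c b)), true, []⟩).act [] w).comp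
        ((Lam c w).act (phi f G (G : Set S) (psiLetter c b)) []) := by
  cases w with
  | nil => simp [Lam, DPath.comp, DPath.act, DPath.nil, DPath.ofEdge, DEdge.act]
  | cons b' w => rfl

@[simp] lemma start_Lam (w : List (Letter f G)) : (Lam c w).start = w := by
  cases w with
  | nil => rfl
  | cons b w => simp [Lam_cons, DEdge.src]

include hG

@[simp] lemma tgt_Lam (w : List (Letter f G)) :
    (Lam c w).tgt = phi f G (G : Set S) (psi c w) := by
  induction w with
  | nil => rfl
  | cons b w ih =>
    have := phi_psi_append hG c [b] w
    simp only [psi_cons, psi_nil, List.append_nil, List.cons_append, List.nil_append] at this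
    rw [Lam_cons, DPath.tgt_comp (by simp [DEdge.tgt])]
    simp [ih, this]

lemma Lam_append (u v : List (Letter f G)) :
    Lam c (u ++ v) =
      ((Lam c u).act [] v).comp ((Lam c v).act (phi f G (G : Set S) (psi c u)) []) := by
  induction u with
  | nil =>
    have : (Lam c [] : DPath (Letter f G)) = DPath.nil [] := rfl
    rw [this, psi_nil, phi_nil, DPath.act_nil_nil]
    exact (DPath.nil_comp (by simp)).symm
  | cons b u ih =>
    have := phi_psi_append hG c [b] u
    simp only [psi_cons, psi_nil, List.append_nil, List.cons_append, List.nil_append] at this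
    rw [List.cons_append, Lam_cons, Lam_cons, ih]
    simp [DPath.act_comp, DPath.act_act, DPath.comp_assoc, this]

omit hG in
lemma isChain_Lam (w : List (Letter f G)) :
    IsChain (groupRel c R) (Lam c w).start (Lam c w).edges := by
  induction w with
  | nil => trivial
  | cons b w ih =>
    have h : IsChain (groupRel c R) [b]
        [⟨[], ([b], phi f G (G : Set S) (psiLetter c b)), true, []⟩] :=
      ⟨Or.inr ⟨b, rfl⟩, rfl, trivial⟩
    rw [Lam_cons]
    refine (isChain_append _ _ _).2 ⟨h.act [] w, ?_⟩
    have ih := ih.act (phi f G (G : Set S) (psiLetter c b)) []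
    rw [start_Lam] at ih
    simpa [DPath.act, DPath.ofEdge, endVertex, DEdge.tgt, DEdge.act] using ih

omit hG in
lemma isPath_Lam {w : List (Letter f G)} (h : w ≠ []) : IsPath (groupRel c R) (Lam c w) :=
  ⟨by simpa using h, isChain_Lam c w⟩

end Lam

/-! ### Parallel paths are homotopic after applying `φ` -/

/-- The relation `φ(i, P) ∼ φ(i, Q)` for all `i` with `i (ι P) ≠ 0`, on parallel paths `P`, `Q`,
is a homotopy relation. -/
lemma isHomotopyRelation_phiPath (hR : ∀ r ∈ R, r.1 ≠ [] ∧ r.2 ≠ [])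
    (hv : ∀ r ∈ R, val f r.1 = val f r.2) (hG : IsSubgroup G) (c : CosetWords f G)
    {sim : DPath (Letter f G) → DPath (Letter f G) → Prop}
    (H : IsHomotopyRelation (groupRel c R) sim) :
    IsHomotopyRelation R fun P Q => Parallel R P Q ∧
      ∀ C, Admissible f G C P.start → sim (phiPath f G C P) (phiPath f G C Q) := by
  have hpar := parallel_isHomotopyRelation hR
  have hU := groupRel_ne_nil hR hv hG c
  refine ⟨fun _ _ h => h.1, ?_, ?_, ?_, ?_, ?_, ?_, ?_⟩
  · exact fun P hP => ⟨hpar.refl P hP, fun C hC => H.refl _ (isPath_phiPath hv c hP hC)⟩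
  · exact fun P Q h => ⟨hpar.symm _ _ h.1, fun C hC => H.symm _ _ (h.2 C (h.1.2.2.1 ▸ hC))⟩
  · exact fun P Q T h h' => ⟨hpar.trans _ _ _ h.1 h'.1, fun C hC =>
      H.trans _ _ _ (h.2 C hC) (h'.2 C (h.1.2.2.1 ▸ hC))⟩
  · intro E₁ E₂ h₁ h₂
    refine ⟨hpar.h1 E₁ E₂ h₁ h₂, fun C hC => ?_⟩
    have e₁ := E₁.val_src_eq_val_tgt hv h₁
    have e₂ := E₂.val_src_eq_val_tgt hv h₂
    have p₁ := isPath_ofEdge hR h₁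
    have p₂ := isPath_ofEdge hR h₂
    have hC : Admissible f G C (E₁.src ++ E₂.src) := by simpa using hC
    have h21 : Admissible f G C (E₁.tgt ++ E₂.src) := hC.congr (by simp [e₁])
    have h12 : Admissible f G C (E₁.src ++ E₂.tgt) := hC.congr (by simp [e₂])
    have key := H.h1 (phiEdge f G C E₁) (phiEdge f G (wordAct f C E₁.src) E₂)
      (phiEdge_rule_mem hv c h₁ hC.left) (phiEdge_rule_mem hv c h₂ hC.right)
    have hof : ∀ {C : Set S} {E : DEdge A}, E.rule ∈ R → Admissible f G C E.src →
        phiPath f G C (DPath.ofEdge E) = DPath.ofEdge (phiEdge f G C E) := by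
      intro C E hE hC
      simp [phiPath, DPath.ofEdge, (phiEdge_src_tgt hv hE hC).1]
    obtain ⟨s₁, t₁⟩ := phiEdge_src_tgt hv h₁ hC.left
    obtain ⟨s₂, t₂⟩ := phiEdge_src_tgt hv h₂ hC.right
    rw [s₁, s₂, t₁, t₂] at key
    rw [phiPath_comp, phiPath_comp, phiPath_act hv p₁ (by simpa using hC),
      phiPath_act hv p₂ (by simpa using h21), phiPath_act hv p₂ (by simpa using hC),
      phiPath_act hv p₁ (by simpa using h12)]
    simpa [hof h₁ hC.left, hof h₂ hC.right, ← wordAct_congr C e₁] using key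
  · intro P Q h x y
    refine ⟨hpar.h2 P Q h.1 x y, fun C hC => ?_⟩
    have hC' : Admissible f G C (x ++ Q.start ++ y) := by
      rw [← h.1.2.2.1]
      exact hC
    rw [phiPath_act hv h.1.1 hC, phiPath_act hv h.1.2.1 hC', ← h.1.2.2.1]
    have hl : Admissible f G C (x ++ P.start) := Admissible.left hC
    exact H.h2 _ _ (h.2 _ hl.right) _ _
  · intro P Q T T' h hT hT' e e'
    refine ⟨hpar.h3 P Q T T' h.1 hT hT' e e', fun C hC => ?_⟩
    simp only [phiPath_comp]
    have hC : Admissible f G C T.start := hC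
    have hP : Admissible f G C P.start := e ▸ hC.congr (val_endVertex hv hT.2)
    have hT'' : Admissible f G C T'.start := e' ▸ hP.congr (val_endVertex hv h.1.1.2)
    exact H.h3 _ _ _ _ (h.2 C hP) (isPath_phiPath hv c hT hC) (isPath_phiPath hv c hT' hT'')
      (by rw [tgt_phiPath hv c hT hC, e]; rfl) (by rw [tgt_phiPath hv c h.1.1 hP, ← e']; rfl)
  · intro P hP
    refine ⟨hpar.h4 P hP, fun C hC => ?_⟩
    rw [phiPath_comp, phiPath_inv hv c hP hC]
    exact H.h4 _ (isPath_phiPath hv c hP hC)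

lemma sim_phiPath_of_parallel (hR : ∀ r ∈ R, r.1 ≠ [] ∧ r.2 ≠ [])
    (hv : ∀ r ∈ R, val f r.1 = val f r.2) (hG : IsSubgroup G) (c : CosetWords f G)
    {sim : DPath (Letter f G) → DPath (Letter f G) → Prop}
    (H : IsHomotopyRelation (groupRel c R) sim) {X : Set (DPath A)}
    (hX : IsClosedHomotopyBase R X)
    (hK : ∀ P ∈ setK f G X, sim P (DPath.nil P.start)) {P Q : DPath A} (h : Parallel R P Q)
    {C : Set S} (hC : Admissible f G C P.start) :
    sim (phiPath f G C P) (phiPath f G C Q) := by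
  refine ((hX.2.2 P Q).2 h _ (isHomotopyRelation_phiPath hR hv hG c H) ?_).2 C hC
  rintro _ ⟨P, hP, rfl⟩
  exact ⟨hX.2.1 _ ⟨P, hP, rfl⟩, fun C hC => hK _ ⟨P, hP, C, hC.1, hC.2, rfl⟩⟩

/-! ### Paths over `B` are conjugate to images of paths over `A` -/

namespace IsHomotopyRelation

variable {B : Type*} {U : Set (List B × List B)} {sim : DPath B → DPath B → Prop}

/-- `X Y⁻¹ Z⁻¹ ∼ 1` implies `X ∼ Z Y`. -/
lemma of_comp_inv_comp_inv (H : IsHomotopyRelation U sim) (hU : ∀ r ∈ U, r.1 ≠ [] ∧ r.2 ≠ [])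
    {X Y Z : DPath B} (hX : IsPath U X) (hY : IsPath U Y) (hZ : IsPath U Z)
    (hXY : X.tgt = Y.tgt) (hYZ : Z.tgt = Y.start) (hXZ : X.start = Z.start)
    (h : sim ((X.comp Y.inv).comp Z.inv) (DPath.nil X.start)) : sim X (Z.comp Y) := by
  have hY' := hY.inv hU
  have hZ' := hZ.inv hU
  have hZY := hZ.comp hY hYZ
  have e₁ : X.tgt = Y.inv.start := hXY
  have e₂ : (Z.comp Y).tgt = Y.inv.start := DPath.tgt_comp hYZ
  have e₃ : (X.comp Y.inv).tgt = Z.inv.start := by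
    rw [DPath.tgt_comp e₁, hY.tgt_inv, ← hYZ]
    rfl
  have e₄ : ((Z.comp Y).comp Y.inv).tgt = Z.inv.start := by
    rw [DPath.tgt_comp e₂, hY.tgt_inv, ← hYZ]
    rfl
  have s : sim ((Z.comp Y).comp Y.inv) Z := by
    have := H.comp_left hU (H.h4 Y hY) hZ hYZ
    rwa [← DPath.comp_assoc, DPath.comp_nil] at this
  have t := H.trans _ _ _ (H.comp_right s hZ' e₄) (H.h4 Z hZ)
  rw [← hXZ] at t
  exact H.cancel_right hU hX hZY hY' e₁ e₂
    (H.cancel_right hU (hX.comp hY' e₁) (hZY.comp hY' e₂) hZ' e₃ e₄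
      (H.trans _ _ _ h (H.symm _ _ t)))

end IsHomotopyRelation

/-- There is a path `T` over `A`, in the role of `ψ(P)`, from `ψ(ι P)` to `ψ(τ P)` and
such that `P Λ_{τ P} ∼ Λ_{ι P} φ(T)`. -/
def HasLift (c : CosetWords f G) (R : Set (List A × List A))
    (sim : DPath (Letter f G) → DPath (Letter f G) → Prop) (P : DPath (Letter f G)) : Prop :=
  ∃ T, IsPath R T ∧ T.start = psi c P.start ∧ T.tgt = psi c P.tgt ∧
    sim (P.comp (Lam c P.tgt)) ((Lam c P.start).comp (phiPath f G (G : Set S) T))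

section Lift

variable {c : CosetWords f G} {sim : DPath (Letter f G) → DPath (Letter f G) → Prop}

lemma phiPath_of_psi (hv : ∀ r ∈ R, val f r.1 = val f r.2) (hG : IsSubgroup G)
    {w : List (Letter f G)} {T : DPath A} (hT : IsPath R T) (e : T.start = psi c w) :
    Admissible f G (G : Set S) T.start ∧ IsPath (groupRel c R) (phiPath f G (G : Set S) T) ∧
      (phiPath f G (G : Set S) T).tgt = phi f G (G : Set S) T.tgt := by
  have ha : Admissible f G (G : Set S) T.start := e ▸ admissible_psi hG c w
  exact ⟨ha, isPath_phiPath hv c hT ha, tgt_phiPath hv c hT ha⟩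

variable (H : IsHomotopyRelation (groupRel c R) sim) (hR : ∀ r ∈ R, r.1 ≠ [] ∧ r.2 ≠ [])
  (hv : ∀ r ∈ R, val f r.1 = val f r.2) (hG : IsSubgroup G)

include H

lemma HasLift.nil {v : List (Letter f G)} (h : v ≠ []) : HasLift c R sim (DPath.nil v) := by
  refine ⟨DPath.nil (psi c v), isPath_nil (psi_ne_nil c h), rfl, rfl, ?_⟩
  have : phiPath f G (G : Set S) (DPath.nil (psi c v)) = DPath.nil _ := rfl
  rw [this, DPath.comp_nil, DPath.nil_comp (by simp)]
  exact H.refl _ (isPath_Lam c h)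

include hR hv hG

lemma HasLift.comp {P Q : DPath (Letter f G)} (hP : IsPath (groupRel c R) P)
    (e : P.tgt = Q.start) (lP : HasLift c R sim P) (lQ : HasLift c R sim Q) :
    HasLift c R sim (P.comp Q) := by
  obtain ⟨T, hT, s, t, h⟩ := lP
  obtain ⟨T', hT', s', t', h'⟩ := lQ
  have hU := groupRel_ne_nil hR hv hG c
  obtain ⟨-, pT, eT⟩ := phiPath_of_psi hv hG hT s
  obtain ⟨-, pT', eT'⟩ := phiPath_of_psi hv hG hT' s'
  have es : T.tgt = T'.start := by rw [t, s', e]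
  refine ⟨T.comp T', hT.comp hT' es, s, ?_, ?_⟩
  · rw [DPath.tgt_comp es, DPath.tgt_comp e, t']
  · have h1 := H.comp_left hU h' hP (by simpa using e)
    have h2 := H.comp_right h pT' (by
      rw [DPath.tgt_comp (by simp), tgt_Lam hG, start_phiPath, s', e])
    rw [DPath.tgt_comp e, phiPath_comp, DPath.comp_assoc, ← DPath.comp_assoc (Lam c _)]
    refine H.trans _ _ _ h1 ?_
    rw [← DPath.comp_assoc, ← e]
    exact h2

/-- If `T` is a lift of `P` then `T⁻¹` is a lift of `P⁻¹`: both `P⁻¹ Λ_{ι P} φ(T)` and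
`Λ_{τ P} φ(T)⁻¹ φ(T)` are homotopic to `Λ_{τ P}`. -/
lemma HasLift.inv {P : DPath (Letter f G)} (hP : IsPath (groupRel c R) P)
    (lP : HasLift c R sim P) : HasLift c R sim P.inv := by
  obtain ⟨T, hT, s, t, h⟩ := lP
  have hU := groupRel_ne_nil hR hv hG c
  obtain ⟨aT, pT, eT⟩ := phiPath_of_psi hv hG hT s
  have hι := isPath_Lam (R := R) c hP.1
  have hτ := isPath_Lam (R := R) c (hP.tgt_ne_nil hU)
  have hP' := hP.inv hU
  have pT' := pT.inv hU
  refine ⟨T.inv, hT.inv hR, t, by rw [hT.tgt_inv, hP.tgt_inv, s], ?_⟩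
  rw [hP.tgt_inv, phiPath_inv hv c hT aT]
  have c1 : P.inv.tgt = (Lam c P.start).start := by simp [hP.tgt_inv]
  have c2 : (Lam c P.inv.start).tgt = (phiPath f G (G : Set S) T).inv.start := by
    simp [tgt_Lam hG, eT, t]
  have c3 : (Lam c P.start).tgt = (phiPath f G (G : Set S) T).start := by simp [tgt_Lam hG, s]
  refine H.cancel_right hU (hP'.comp hι c1) (hτ.comp pT' c2) pT
    (by rw [DPath.tgt_comp c1, c3]) (by rw [DPath.tgt_comp c2, pT.tgt_inv]) ?_
  have h1 := H.comp_left hU h hP' (by simp [hP.tgt_inv])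
  have h2 := H.comp_right (H.inv_comp hU hP) hτ (by simp [hP.tgt_inv])
  have h3 := H.comp_left hU (H.inv_comp hU pT) hτ (by simp [tgt_Lam hG, eT, t])
  rw [DPath.nil_comp (by simp)] at h2
  rw [DPath.comp_nil] at h3
  rw [DPath.comp_assoc, DPath.comp_assoc]
  refine H.trans _ _ _ (H.symm _ _ h1) (H.trans _ _ _ ?_ (H.symm _ _ h3))
  rwa [← DPath.comp_assoc]

/-- If `T` is a lift of `P` then `ψ(x) · T` is a lift of `x · P`: the interchange law moves
`Λ_x` to the front of `x · P`, which becomes `φ(ψ(x)) · P`. -/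
lemma HasLift.act_left {P : DPath (Letter f G)} (hP : IsPath (groupRel c R) P)
    (lP : HasLift c R sim P) (x : List (Letter f G)) : HasLift c R sim (P.act x []) := by
  obtain ⟨T, hT, s, t, h⟩ := lP
  have hU := groupRel_ne_nil hR hv hG c
  refine ⟨T.act (psi c x) [], hT.act _ _, by simp [s, psi_append], by simp [t, psi_append], ?_⟩
  have aT' : Admissible f G (G : Set S) (psi c x ++ T.start ++ []) := by
    simpa [s, psi_append] using admissible_psi hG c (x ++ P.start)
  have hτ := isPath_Lam (R := R) c (hP.tgt_ne_nil hU)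
  have hx : IsPath (groupRel c R) ((Lam c x).act [] P.start) :=
    ⟨by simp [hP.1], (isChain_Lam c x).act [] P.start⟩
  have h1 := H.interchange hU (P := Lam c x) (Q := P) (isChain_Lam c x) hP.2 (by simp [hP.1])
  rw [start_Lam, tgt_Lam hG] at h1
  have h2 := H.comp_right (H.symm _ _ h1) (hτ.act (phi f G (G : Set S) (psi c x)) [])
    (by simp [tgt_Lam hG])
  have h3 := H.comp_left hU (H.h2 _ _ h (phi f G (G : Set S) (psi c x)) []) hx
    (by simp [tgt_Lam hG])
  rw [phiPath_act hv hT aT', wordAct_psi hG]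
  simp only [DPath.act_comp, DPath.comp_assoc] at h2 h3
  simpa [Lam_append hG, DPath.comp_assoc] using H.trans _ _ _ h2 h3

/-- If `T` is a lift of `P` then `T · ψ(y)` is a lift of `P · y`: the interchange law moves
`Λ_y` in front of `φ(T)`. -/
lemma HasLift.act_right {P : DPath (Letter f G)} (hP : IsPath (groupRel c R) P)
    (lP : HasLift c R sim P) (y : List (Letter f G)) : HasLift c R sim (P.act [] y) := by
  obtain ⟨T, hT, s, t, h⟩ := lP
  have hU := groupRel_ne_nil hR hv hG c
  obtain ⟨aT, pT, eT⟩ := phiPath_of_psi hv hG hT s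
  refine ⟨T.act [] (psi c y), hT.act _ _, by simp [s, psi_append], by simp [t, psi_append], ?_⟩
  have aT' : Admissible f G (G : Set S) ([] ++ T.start ++ psi c y) := by
    simpa [s, psi_append] using admissible_psi hG c (P.start ++ y)
  have hι := isPath_Lam (R := R) c hP.1
  have h1 := H.interchange hU (P := phiPath f G (G : Set S) T) (Q := Lam c y) pT.2
    (isChain_Lam c y) (by simp [phi_ne_nil aT hT.1])
  rw [start_Lam, tgt_Lam hG, start_phiPath, eT, s, t] at h1
  have h2 := H.comp_left hU h1 (hι.act [] y) (by simp [tgt_Lam hG, s])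
  have hy : IsPath (groupRel c R) ((Lam c y).act (phi f G (G : Set S) (psi c P.tgt)) []) :=
    ⟨by simp [phi_ne_nil (admissible_psi hG c _) (psi_ne_nil c (hP.tgt_ne_nil hU))],
      (isChain_Lam c y).act _ []⟩
  have h3 := H.comp_right (H.h2 _ _ h [] y) hy (by simp [tgt_Lam hG])
  rw [phiPath_act hv hT aT', List.nil_append, s, wordAct_psi hG, wordAct_nil, phi_nil]
  simp only [DPath.act_comp, DPath.comp_assoc] at h2 h3
  simpa [Lam_append hG, DPath.comp_assoc] using H.trans _ _ _ h3 h2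

/-- Every path over `B` has a lift if the edges `E_r` have one. -/
lemma HasLift.of_isPath
    (hbase : ∀ r ∈ groupRel c R, HasLift c R sim (DPath.ofEdge ⟨[], r, true, []⟩))
    {P : DPath (Letter f G)} (hP : IsPath (groupRel c R) P) : HasLift c R sim P := by
  have hU := groupRel_ne_nil hR hv hG c
  have hedge : ∀ E : DEdge (Letter f G), E.rule ∈ groupRel c R →
      HasLift c R sim (DPath.ofEdge E) := by
    rintro ⟨x, r, ε, y⟩ hr
    have hr : r ∈ groupRel c R := hr
    have p := isPath_ofEdge hU (E := ⟨[], r, true, []⟩) hr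
    -- Acting by `x` and `y` reduces the claim to the edges `E_r` and `E_r⁻¹`.
    have key : ∀ ε, IsPath (groupRel c R) (DPath.ofEdge ⟨[], r, ε, []⟩) →
        HasLift c R sim (DPath.ofEdge ⟨[], r, ε, []⟩) →
        HasLift c R sim (DPath.ofEdge ⟨x, r, ε, y⟩) := by
      intro ε p l
      have := (l.act_left H hR hv hG p x).act_right H hR hv hG (p.act x []) y
      rw [DPath.act_act] at this
      convert this using 1
      cases ε <;> simp [DPath.act, DPath.ofEdge, DEdge.act, DEdge.src]
    have e : (DPath.ofEdge ⟨[], r, true, []⟩ : DPath (Letter f G)).inv =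
        DPath.ofEdge ⟨[], r, false, []⟩ := by
      simp [DPath.inv, DPath.ofEdge, DEdge.inv, DEdge.src, DEdge.tgt, DPath.tgt, endVertex]
    cases ε
    · exact key false (e ▸ p.inv hU) (e ▸ (hbase r hr).inv H hR hv hG p)
    · exact key true p (hbase r hr)
  obtain ⟨v, l⟩ := P
  induction l generalizing v with
  | nil => exact HasLift.nil H hP.1
  | cons E l ih =>
    obtain ⟨-, h1, rfl, h3⟩ := hP
    exact (hedge E h1).comp H hR hv hG (Q := ⟨E.tgt, l⟩) (isPath_ofEdge hU h1) rfl
      (ih E.tgt ⟨DEdge.tgt_ne_nil hU h1, h3⟩)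

end Lift

section Base

variable (hR : ∀ r ∈ R, r.1 ≠ [] ∧ r.2 ≠ []) (hv : ∀ r ∈ R, val f r.1 = val f r.2)
  (hG : IsSubgroup G) (c : CosetWords f G)
  {psiE : List (Letter f G) × List (Letter f G) → DPath A}
  (hpsiE : ∀ u ∈ groupRel c R, IsPath R (psiE u) ∧
    (psiE u).start = psi c u.1 ∧ (psiE u).tgt = psi c u.2)

include hR hv hG hpsiE

/-- If `W` is trivial for `∼`, then `ψ(E_r)` is a lift of `E_r`. -/
lemma hasLift_ofEdge {sim : DPath (Letter f G) → DPath (Letter f G) → Prop}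
    (H : IsHomotopyRelation (groupRel c R) sim)
    (hW : ∀ P ∈ setW c R psiE, sim P (DPath.nil P.start))
    {r : List (Letter f G) × List (Letter f G)}
    (hr : r ∈ groupRel c R) : HasLift c R sim (DPath.ofEdge ⟨[], r, true, []⟩) := by
  obtain ⟨hT, s, t⟩ := hpsiE r hr
  have hU := groupRel_ne_nil hR hv hG c
  obtain ⟨-, pT, eT⟩ := phiPath_of_psi hv hG hT s
  have p := isPath_ofEdge hU (E := ⟨[], r, true, []⟩) hr
  have e₁ : (⟨[], r, true, []⟩ : DEdge (Letter f G)).src = r.1 := by simp [DEdge.src]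
  have e₂ : (⟨[], r, true, []⟩ : DEdge (Letter f G)).tgt = r.2 := by simp [DEdge.tgt]
  refine ⟨psiE r, hT, by simp [e₁, s], by simp [e₂, t], ?_⟩
  have h := hW _ ⟨r, hr, rfl⟩
  rw [DPath.tgt_ofEdge, DPath.start_ofEdge, e₁, e₂]
  exact H.of_comp_inv_comp_inv hU (p.comp (isPath_Lam c (hU r hr).2) (by simp [e₂])) pT
    (isPath_Lam c (hU r hr).1) (by rw [DPath.tgt_comp (by simp [e₂]), tgt_Lam hG, eT, t])
    (by rw [tgt_Lam hG, start_phiPath, s]) (by simp [e₁]) h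

lemma closed_of_mem {X : Set (DPath A)} (hX : ∀ P ∈ X, IsPath R P ∧ P.tgt = P.start) :
    ∀ P ∈ setK f G X ∪ setW c R psiE, IsPath (groupRel c R) P ∧ P.tgt = P.start := by
  have hU := groupRel_ne_nil hR hv hG c
  rintro _ (⟨P, hP, C, hC, hC', rfl⟩ | ⟨r, hr, rfl⟩)
  · obtain ⟨h1, h2⟩ := hX P hP
    exact ⟨isPath_phiPath hv c h1 ⟨hC, hC'⟩, by rw [tgt_phiPath hv c h1 ⟨hC, hC'⟩, h2]; rfl⟩
  · obtain ⟨hT, s, t⟩ := hpsiE r hr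
    obtain ⟨-, pT, eT⟩ := phiPath_of_psi hv hG hT s
    have p := isPath_ofEdge hU (E := ⟨[], r, true, []⟩) hr
    have l₁ := isPath_Lam (R := R) c (hU r hr).1
    have l₂ := isPath_Lam (R := R) c (hU r hr).2
    have a₁ : (DPath.ofEdge ⟨[], r, true, []⟩).tgt = (Lam c r.2).start := by simp [DEdge.tgt]
    have a₂ : ((DPath.ofEdge ⟨[], r, true, []⟩).comp (Lam c r.2)).tgt =
        (phiPath f G (G : Set S) (psiE r)).inv.start := by
      rw [DPath.tgt_comp a₁, tgt_Lam hG, DPath.start_inv, eT, t]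
    have a₃ : (((DPath.ofEdge ⟨[], r, true, []⟩).comp (Lam c r.2)).comp
        (phiPath f G (G : Set S) (psiE r)).inv).tgt = (Lam c r.1).inv.start := by
      rw [DPath.tgt_comp a₂, pT.tgt_inv, start_phiPath, DPath.start_inv, tgt_Lam hG, s]
    refine ⟨((p.comp l₂ a₁).comp (pT.inv hU) a₂).comp (l₁.inv hU) a₃, ?_⟩
    rw [DPath.tgt_comp a₃, l₁.tgt_inv]
    simp [DEdge.src]

lemma isClosedHomotopyBase_union {X : Set (DPath A)} (hX : IsClosedHomotopyBase R X) :
    IsClosedHomotopyBase (groupRel c R) (setK f G X ∪ setW c R psiE) := by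
  have hU := groupRel_ne_nil hR hv hG c
  have hcl := closed_of_mem hR hv hG c hpsiE hX.1
  have hpar : ∀ p ∈ (fun P => (P, DPath.nil P.start)) '' (setK f G X ∪ setW c R psiE),
      Parallel (groupRel c R) p.1 p.2 := by
    rintro _ ⟨P, hP, rfl⟩
    obtain ⟨h1, h2⟩ := hcl P hP
    exact ⟨h1, isPath_nil h1.1, rfl, h2⟩
  refine ⟨hcl, hpar, fun P Q => ⟨fun h => h _ (parallel_isHomotopyRelation hU) hpar, ?_⟩⟩
  rintro ⟨hP, hQ, es, et⟩ sim H hsim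
  have hnil : ∀ P ∈ setK f G X ∪ setW c R psiE, sim P (DPath.nil P.start) :=
    fun P hP => hsim _ ⟨P, hP, rfl⟩
  have lift : ∀ {P}, IsPath (groupRel c R) P → HasLift c R sim P := fun hP =>
    HasLift.of_isPath H hR hv hG
      (fun r hr => hasLift_ofEdge hR hv hG c hpsiE H (fun P hP => hnil P (Or.inr hP)) hr) hP
  obtain ⟨T, hT, s, t, h⟩ := lift hP
  obtain ⟨T', hT', s', t', h'⟩ := lift hQ
  obtain ⟨aT, -, -⟩ := phiPath_of_psi hv hG hT s
  have hTT := sim_phiPath_of_parallel hR hv hG c H hX (fun P hP => hnil P (Or.inl hP))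
    (P := T) (Q := T') ⟨hT, hT', by rw [s, s', es], by rw [t, t', et]⟩ aT
  have h2 := H.comp_left hU hTT (isPath_Lam c hP.1) (by simp [tgt_Lam hG, s])
  rw [← es, ← et] at h'
  exact H.cancel_right hU hP hQ (isPath_Lam c (hP.tgt_ne_nil hU)) (by simp) (by simp [et])
    (H.trans _ _ _ h (H.trans _ _ _ h2 (H.symm _ _ h')))

end Base

/-! ### The presentation of `G` -/

/-- The value of `w` in `G` and the value of `ψ(w)` in `S` agree if they do so for letters. -/
lemma map_val_eq_val_psi (c : CosetWords f G) {γ : Letter f G → G}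
    (hγ : ∀ b, ((γ b : S) : WithOne S) = val f (psiLetter c b)) (w : List (Letter f G)) :
    WithOne.mapMulHom (MulMemClass.subtype G) (val γ w) = val f (psi c w) := by
  induction w with
  | nil => simp
  | cons b w ih => simp [ih, ← hγ]

lemma presents_groupRel (hR : Presents R f) (hG : IsSubgroup G) (c : CosetWords f G)
    {γ : Letter f G → G} (hγ : ∀ b, ((γ b : S) : WithOne S) = val f (psiLetter c b))
    (hv : ∀ r ∈ R, val f r.1 = val f r.2) : Presents (groupRel c R) γ := by
  have hU := groupRel_ne_nil hR.rules_nonempty hv hG c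
  have hmap := map_val_eq_val_psi c hγ
  have hinj : Function.Injective (WithOne.mapMulHom (MulMemClass.subtype G)) :=
    WithOne.mapMulHom_injective Subtype.val_injective
  have hiff : ∀ u v, val γ u = val γ v ↔ val f (psi c u) = val f (psi c v) := fun u v => by
    rw [← hmap, ← hmap, hinj.eq_iff]
  refine ⟨hU, ?_, ?_⟩
  · rintro ⟨g, hg⟩
    obtain ⟨w, hw, e⟩ := hR.surjective g
    have ha : Admissible f G (G : Set S) w :=
      ⟨isRightCoset_self hG, by rw [wordAct_of_mem hG hg e]; exact isRightCoset_self hG⟩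
    refine ⟨phi f G (G : Set S) w, phi_ne_nil ha hw, hinj ?_⟩
    rw [hmap, val_psi_phi_of_mem hG c hg e]
    rfl
  · intro u v hu hv0
    rw [hiff]
    constructor
    · intro h
      have key : ∀ w : List (Letter f G), Relation.EqvGen (Step (groupRel c R)) w
          (phi f G (G : Set S) (psi c w)) := by
        intro w
        have := (isChain_Lam (R := R) c w).eqvGen_step
        change Relation.EqvGen _ (Lam c w).start (Lam c w).tgt at this
        rwa [tgt_Lam hG, start_Lam] at this
      have h1 := (hR.eq_iff _ _ (psi_ne_nil c hu) (psi_ne_nil c hv0)).1 h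
      exact .trans _ _ _ (key u) (.trans _ _ _ (eqvGen_phi hv c h1 (admissible_psi hG c u))
        (.symm _ _ (key v)))
    · intro h
      rw [← hiff]
      refine val_eq_of_eqvGen ?_ h
      rintro _ (⟨C, hC, r, hr, hCr, rfl⟩ | ⟨b, rfl⟩)
      · rw [hiff]
        exact val_psi_phi_congr c ⟨hC, hCr⟩ (hR.rules_nonempty r hr).1
          (hR.rules_nonempty r hr).2 (hv r hr)
      · rw [hiff, val_psi_phi_of_mem hG c (γ b).2 (hγ b).symm, hγ b]
        simp

end Coset

end HomotopyBases

theorem theorem3p3 {A S : Type*} [Semigroup S]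
    -- a presentation `⟨A | R⟩` of `S`, with a homotopy base `X` of closed paths
    (R : Set (List A × List A)) (f : A → S) (hR : HomotopyBases.Presents R f)
    (X : Set (HomotopyBases.DPath A)) (hX : HomotopyBases.IsClosedHomotopyBase R X)
    -- a subgroup `G` of `S`, and the words `e`, `r_i`, `r_i'`
    (G : Subsemigroup S) (hG : HomotopyBases.IsSubgroup G)
    (c : HomotopyBases.CosetWords f G)
    -- for each `u ∈ U`, a path `ψ(E_u)` from `ψ(u₊₁)` to `ψ(u₋₁)`
    (psiE : List (HomotopyBases.Letter f G) × List (HomotopyBases.Letter f G) →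
      HomotopyBases.DPath A)
    (hpsiE : ∀ u ∈ HomotopyBases.groupRel c R, HomotopyBases.IsPath R (psiE u) ∧
      (psiE u).start = HomotopyBases.psi c u.1 ∧ (psiE u).tgt = HomotopyBases.psi c u.2) :
    -- `⟨B | U⟩` is a presentation of `G`, the letter `b` representing the value of `ψ(b)`
    (∃ γ : HomotopyBases.Letter f G → G,
      (∀ b, ((γ b : S) : WithOne S) = HomotopyBases.val f (HomotopyBases.psiLetter c b)) ∧
        HomotopyBases.Presents (HomotopyBases.groupRel c R) γ) ∧
    -- and `K ∪ W` is a set of closed paths that is a homotopy base for it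
    HomotopyBases.IsClosedHomotopyBase (HomotopyBases.groupRel c R)
      (HomotopyBases.setK f G X ∪ HomotopyBases.setW c R psiE) := by
  have hv : ∀ r ∈ R, HomotopyBases.val f r.1 = HomotopyBases.val f r.2 := fun r hr =>
    (hR.eq_iff _ _ (hR.rules_nonempty r hr).1 (hR.rules_nonempty r hr).2).2
      (.rel _ _ ⟨r, hr, [], [], by simp, by simp⟩)
  have hletter : ∀ b : HomotopyBases.Letter f G, ∃ g : G,
      ((g : S) : WithOne S) = HomotopyBases.val f (HomotopyBases.psiLetter c b) := fun b => by
    obtain ⟨g, hg, e, -⟩ := HomotopyBases.val_psiLetter c b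
    exact ⟨⟨g, hg⟩, e⟩
  choose γ hγ using hletter
  exact ⟨⟨γ, hγ, HomotopyBases.presents_groupRel hR hG c hγ hv⟩,
    HomotopyBases.isClosedHomotopyBase_union hR.rules_nonempty hv hG c hpsiE hX⟩
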